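/- Let $D\subset\mathbb{C}$ be a bounded domain (open and connected) containing the origin, let $V:\mathbb{C}\to\mathbb{R}$ be a smooth function, and let $N\ge 0$ be an integer. There are a unique sequence of polynomials $P_k(z)=z^k+a_{k-1,k}z^{k-1}+\cdots+a_{0k}$ and a unique sequence of real numbers $h_k$, $k=0,1,2,\dots$, with $$\iint_D P_k(z)\overline{P_m(z)}\,e^{-NV(z)}\,d^2z=h_k\delta_{km}\qquad\text{for all } k,m\ge 0 .$$ For $n\ge 1$ set $$Y_n(z)=\begin{pmatrix} P_n(z) & \dfrac1\pi\displaystyle\iint_D\frac{\overline{P_n(z')}}{z'-z}\,e^{-NV(z')}d^2z'\\[2ex] -\dfrac{\pi}{h_{n-1}}P_{n-1}(z) & -\dfrac1{h_{n-1}}\displaystyle\iint_D\frac{\overline{P_{n-1}(z')}}{z'-z}\,e^{-NV(z')}d^2z'\end{pmatrix},\qquad G(z)=\begin{pmatrix}1&e^{-NV(z)}\chi_D(z)\\0&1\end{pmatrix},$$ where $\chi_D$ is the characteristic function of $D$. Then, for every $n\ge 1$, $Y_n$ is the unique solution of the problem $$\frac{\partial}{\partial\bar z}Y(z)=\overline{Y(z)}\,\bigl(I-G(z)\bigr)\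 \text{ on }\mathbb{C},\qquad Y(z)=\Bigl(I+O\Bigl(\frac1z\Bigr)\Bigr)\begin{pmatrix}z^n&0\\0&z^{-n}\end{pmatrix}\ \text{ as } |z|\to\infty,$$ where $I$ is the $2\times2$ identity matrix, $\overline{Y}$ is the entrywise complex conjugate, and the first equation is understood in the sense of distributions, for locally integrable $2\times2$ matrix-valued functions $Y$. Precisely: $Y_n$ is continuous on $\mathbb{C}$, solves the equation, and satisfies the normalization; conversely, every locally integrable solution $Y$ of the equation that satisfies the normalization for almost every $z$ as $|z|\to\infty$ equals $Y_n$ almost everywhere, and every continuous solution that satisfies the normalization equals $Y_n$ everywhere. In particular the first column of any solution consists of $P_n$ and $-\frac{\pi}{h_{n-1}}P_{n-1}$, and the second of their Cauchy transforms as in $Y_n$. -/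

import Mathlib

open MeasureTheory Filter Topology Polynomial Asymptotics
open scoped ComplexConjugate ContDiff

noncomputable section

namespace DbarProblem

/-- The weight `e^{-N V(z)}`. -/
def weight (V : ℂ → ℝ) (N : ℕ) (z : ℂ) : ℂ :=
  ((Real.exp (-(N : ℝ) * V z) : ℝ) : ℂ)

/-- `P 0, P 1, ...` are the orthogonal polynomials with respect to the measure
`e^{-N V(z)} χ_D(z) d²z`, with squared norms `h 0, h 1, ...`: the polynomial `P n` is monic of
degree `n`, and `∬_D P_n conj(P_m) e^{-NV} d²z = h_n δ_{mn}` for all `m`, `n`. -/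
structure IsOrthogonalSystem (D : Set ℂ) (V : ℂ → ℝ) (N : ℕ) (P : ℕ → ℂ[X]) (h : ℕ → ℝ) :
    Prop where
  monic : ∀ n, (P n).Monic
  natDegree_eq : ∀ n, (P n).natDegree = n
  orthogonal : ∀ m n,
    ∫ z in D, (P n).eval z * conj ((P m).eval z) * weight V N z = if m = n then (h n : ℂ) else 0

/-- `∬_D conj(p(z')) / (z' - z) e^{-N V(z')} d²z'`. -/
def cauchyIntegral (D : Set ℂ) (V : ℂ → ℝ) (N : ℕ) (p : ℂ[X]) (z : ℂ) : ℂ :=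
  ∫ z' in D, conj (p.eval z') / (z' - z) * weight V N z'

/-- The matrix `Y_n(z)` (used for `n ≥ 1`). -/
def matrixY (D : Set ℂ) (V : ℂ → ℝ) (N : ℕ) (P : ℕ → ℂ[X]) (h : ℕ → ℝ) (n : ℕ) (z : ℂ) :
    Matrix (Fin 2) (Fin 2) ℂ :=
  !![(P n).eval z,
      1 / (Real.pi : ℂ) * cauchyIntegral D V N (P n) z;
    -((Real.pi : ℂ) / (h (n - 1) : ℂ)) * (P (n - 1)).eval z,
      -(1 / (h (n - 1) : ℂ)) * cauchyIntegral D V N (P (n - 1)) z]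

/-- The matrix `G(z)`, with upper right entry `e^{-N V(z)} χ_D(z)`. -/
def matrixG (D : Set ℂ) (V : ℂ → ℝ) (N : ℕ) (z : ℂ) : Matrix (Fin 2) (Fin 2) ℂ :=
  !![1, D.indicator (weight V N) z; 0, 1]

/-- The operator `∂/∂z̄ = (∂/∂x + i ∂/∂y) / 2` on real-differentiable functions. -/
def dbar (φ : ℂ → ℂ) (z : ℂ) : ℂ :=
  (fderiv ℝ φ z 1 + Complex.I * fderiv ℝ φ z Complex.I) / 2

/-- For locally integrable `u`, `f`: the equation `∂u/∂z̄ = f` in the sense of distributions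
on `ℂ`. -/
def HasWeakDbar (u f : ℂ → ℂ) : Prop :=
  ∀ φ : ℂ → ℂ, ContDiff ℝ ∞ φ → HasCompactSupport φ →
    ∫ z, u z * dbar φ z = -∫ z, f z * φ z

/-- `Y` is locally integrable and solves `∂Y/∂z̄ = conj(Y) (I - G)` on `ℂ` in the sense of
distributions, entry by entry; `conj(Y)` is the entrywise complex conjugate. -/
structure SolvesDbar (D : Set ℂ) (V : ℂ → ℝ) (N : ℕ) (Y : ℂ → Matrix (Fin 2) (Fin 2) ℂ) :
    Prop where
  locallyIntegrable : ∀ i j, LocallyIntegrable (fun z => Y z i j) volume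
  dbar_eq : ∀ i j,
    HasWeakDbar (fun z => Y z i j) (fun z => ((Y z).map conj * (1 - matrixG D V N z)) i j)

/-- The normalization `Y(z) = (I + O(1/z)) z^{n σ₃}` along the filter `l`. -/
def HasNormalization (n : ℕ) (l : Filter ℂ) (Y : ℂ → Matrix (Fin 2) (Fin 2) ℂ) : Prop :=
  ∃ E : ℂ → Matrix (Fin 2) (Fin 2) ℂ,
    (∀ i j, (fun z => E z i j) =O[l] fun z : ℂ => 1 / z) ∧
    ∀ᶠ z in l, Y z = (1 + E z) * !![z ^ n, 0; 0, 1 / z ^ n]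

end DbarProblem

end

namespace DbarProblem

/-! The only nonzero entry of `I - G` is the upper right one, so the problem decouples into rows
`(u, v)` with `∂u/∂z̄ = 0` and `∂v/∂z̄ = -conj(u) e^{-NV} χ_D`.

Existence: polynomials satisfy the first equation, and by the Cauchy–Pompeiu formula the Cauchy
transform of `f` satisfies `∂/∂z̄ = -π f`, which gives the second. For the behaviour at infinity, `z
/ (w - z) = w / (w - z) - 1` shows that each vanishing moment of `f` improves the decay of its
Cauchy transform by one power of `z`. Orthogonality of `P_n` kills its first `n` moments; for
`P_{n-1}` the first nonzero moment is `h_{n-1}`, and this produces the entry 1 of `I`.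

Uniqueness: the equation is only real-linear, but that is enough to subtract two solutions. A row of
the difference has `u = O(z^{n-1})` and `v = O(z^{-n-1})`. Weyl's lemma and Liouville make `u` a
polynomial `p` (`exists_polynomial_of_hasWeakDbar_zero`). Testing the equation for `v` against `p`
gives `∬_D |p|² e^{-NV}` as a limit of boundary terms of `p v = O(z^{-2})`, hence zero
(`pairing_self_eq_zero_of_hasWeakDbar`). So `p = 0`, and `v` is then entire and decaying, hence
zero. Positivity of the weight thus replaces the usual determinant argument, which conjugation would
spoil. -/

theorem continuous_weight {V : ℂ → ℝ} (hV : Continuous V) (N : ℕ) : Continuous (weight V N) := by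
  unfold weight
  fun_prop

theorem integrableOn_of_continuous {D : Set ℂ} (hD : Bornology.IsBounded D) {f : ℂ → ℂ}
    (hf : Continuous f) : IntegrableOn f D :=
  (hf.continuousOn.integrableOn_compact hD.isCompact_closure).mono_set subset_closure

/-- The sesquilinear form `∬_D p conj(q) e^{-N V} d²z`. -/
noncomputable def pairing (D : Set ℂ) (V : ℂ → ℝ) (N : ℕ) (p q : ℂ[X]) : ℂ :=
  ∫ z in D, p.eval z * conj (q.eval z) * weight V N z

/-! ### Orthogonal polynomials for the weighted pairing -/

section pairing

variable {D : Set ℂ} {V : ℂ → ℝ} {N : ℕ}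

theorem integrableOn_pairing (hD : Bornology.IsBounded D) (hV : Continuous V) (p q : ℂ[X]) :
    IntegrableOn (fun z => p.eval z * conj (q.eval z) * weight V N z) D := by
  have := continuous_weight hV N
  have hp := p.continuous
  have hq := q.continuous
  exact integrableOn_of_continuous hD
    ((hp.mul (Complex.continuous_conj.comp hq)).mul this)

theorem pairing_add_left (hD : Bornology.IsBounded D) (hV : Continuous V) (p q r : ℂ[X]) :
    pairing D V N (p + q) r = pairing D V N p r + pairing D V N q r := by
  unfold pairing
  rw [← integral_add (integrableOn_pairing hD hV p r) (integrableOn_pairing hD hV q r)]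
  congr 1
  ext z
  simp [add_mul]

theorem pairing_smul_left (c : ℂ) (p r : ℂ[X]) :
    pairing D V N (c • p) r = c * pairing D V N p r := by
  unfold pairing
  rw [← integral_const_mul]
  congr 1
  ext z
  simp [mul_assoc]

theorem pairing_conj_symm (p q : ℂ[X]) : conj (pairing D V N p q) = pairing D V N q p := by
  unfold pairing
  rw [← integral_conj]
  congr 1
  ext z
  rw [weight, map_mul, map_mul, Complex.conj_conj, Complex.conj_ofReal,
    mul_comm (conj (p.eval z))]

theorem pairing_sub_left (hD : Bornology.IsBounded D) (hV : Continuous V) (p q r : ℂ[X]) :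
    pairing D V N (p - q) r = pairing D V N p r - pairing D V N q r := by
  rw [eq_sub_iff_add_eq, ← pairing_add_left hD hV, sub_add_cancel]

theorem pairing_eq_zero_symm {p q : ℂ[X]} (h : pairing D V N p q = 0) :
    pairing D V N q p = 0 := by
  rw [← pairing_conj_symm, h, map_zero]

theorem pairing_self (p : ℂ[X]) :
    pairing D V N p p = ((∫ z in D, ‖p.eval z‖ ^ 2 * Real.exp (-(N : ℝ) * V z) : ℝ) : ℂ) := by
  unfold pairing
  rw [← integral_complex_ofReal]
  congr 1
  ext z
  rw [Complex.mul_conj, Complex.normSq_eq_norm_sq, weight]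
  push_cast
  rfl

/-- The integrand is continuous and nonnegative, so a zero integral forces it to vanish on all of
the open set `D`, which is infinite because it is a neighbourhood of 0. -/
theorem eq_zero_of_pairing_self (hDo : IsOpen D) (hD0 : (0 : ℂ) ∈ D)
    (hD : Bornology.IsBounded D) (hV : Continuous V) {p : ℂ[X]}
    (h : pairing D V N p p = 0) : p = 0 := by
  rw [pairing_self, Complex.ofReal_eq_zero] at h
  have hc : Continuous fun z : ℂ => ‖p.eval z‖ ^ 2 * Real.exp (-(N : ℝ) * V z) := by
    have := p.continuous
    fun_prop
  have hi : IntegrableOn (fun z : ℂ => ‖p.eval z‖ ^ 2 * Real.exp (-(N : ℝ) * V z)) D :=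
    (hc.continuousOn.integrableOn_compact hD.isCompact_closure).mono_set subset_closure
  rw [integral_eq_zero_iff_of_nonneg (fun z => by positivity) hi] at h
  have h0 : Set.EqOn (fun z : ℂ => ‖p.eval z‖ ^ 2 * Real.exp (-(N : ℝ) * V z)) 0 D :=
    Measure.eqOn_open_of_ae_eq h hDo hc.continuousOn continuousOn_const
  refine p.eq_zero_of_infinite_isRoot (Set.Infinite.mono ?_
    (infinite_of_mem_nhds 0 (hDo.mem_nhds hD0)))
  intro z hz
  have := h0 hz
  simpa [Real.exp_ne_zero] using this

/-- Orthogonality to a sequence of polynomials with `natDegree (P k) = k` implies orthogonality to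
all polynomials of lower degree. -/
theorem pairing_eq_zero_of_degree_lt (hD : Bornology.IsBounded D) (hV : Continuous V)
    {P : ℕ → ℂ[X]} (hP : ∀ k, (P k).Monic) (hdeg : ∀ k, (P k).natDegree = k) {n : ℕ} {r : ℂ[X]}
    (hr : ∀ k < n, pairing D V N (P k) r = 0) (q : ℂ[X]) (hq : q.degree < n) :
    pairing D V N q r = 0 := by
  induction n generalizing q with
  | zero =>
    have : q = 0 := by simpa [Nat.WithBot.lt_zero_iff] using hq
    simp [this, pairing]
  | succ n ih =>
    -- Removing the coefficient of degree `n` with the monic `P n` lowers the degree, and the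
    -- removed multiple is itself orthogonal to `r`.
    have hlt : (q - q.coeff n • P n).degree < n := by
      rw [degree_lt_iff_coeff_zero]
      intro m hm
      rcases hm.eq_or_lt with rfl | hm
      · have : (P n).coeff n = 1 := by
          have := hP n
          rwa [Monic, leadingCoeff, hdeg n] at this
        simp [this]
      · have h1 : q.coeff m = 0 := by
          rw [degree_lt_iff_coeff_zero] at hq
          exact hq m hm
        have h2 : (P n).coeff m = 0 := coeff_eq_zero_of_natDegree_lt (by rw [hdeg]; exact hm)
        simp [h1, h2]
    have h1 := ih (fun k hk => hr k (by omega)) _ hlt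
    rw [pairing_sub_left hD hV, pairing_smul_left, hr n (by omega)] at h1
    simpa using h1

/-- The map `L` from polynomials of degree below `n` to their first `n` moments is injective by
positive definiteness, hence bijective by dimension. Some `p` of lower degree therefore has the same
moments as `X ^ n`, and `X ^ n - p` is the required polynomial. -/
theorem exists_monic_orthogonal (hDo : IsOpen D) (hD0 : (0 : ℂ) ∈ D)
    (hD : Bornology.IsBounded D) (hV : Continuous V) (n : ℕ) :
    ∃ p : ℂ[X], p.Monic ∧ p.natDegree = n ∧
      ∀ q : ℂ[X], q.degree < n → pairing D V N q p = 0 := by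
  let L : degreeLT ℂ n →ₗ[ℂ] (Fin n → ℂ) :=
    { toFun := fun p k => pairing D V N p (X ^ (k : ℕ))
      map_add' := fun p q => by
        ext k
        simp [pairing_add_left hD hV]
      map_smul' := fun c p => by
        ext k
        simp [pairing_smul_left] }
  have key : ∀ p : ℂ[X], (∀ k : Fin n, pairing D V N p (X ^ (k : ℕ)) = 0) →
      ∀ q : ℂ[X], q.degree < n → pairing D V N q p = 0 := fun p hp =>
    pairing_eq_zero_of_degree_lt hD hV (P := fun k => X ^ k) (fun k => monic_X_pow k)
      (fun k => natDegree_X_pow k) (fun k hk => pairing_eq_zero_symm (hp ⟨k, hk⟩))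
  have hinj : Function.Injective L := by
    rw [injective_iff_map_eq_zero]
    intro p hp
    have := key p (fun k => congrFun hp k) p (mem_degreeLT.1 p.2)
    exact Subtype.ext (eq_zero_of_pairing_self hDo hD0 hD hV this)
  have e := degreeLTEquiv ℂ n
  have : FiniteDimensional ℂ (degreeLT ℂ n) := e.symm.finiteDimensional
  have hsurj : Function.Surjective L :=
    (LinearMap.injective_iff_surjective_of_finrank_eq_finrank e.finrank_eq).1 hinj
  obtain ⟨p, hp⟩ := hsurj fun k => pairing D V N (X ^ n) (X ^ (k : ℕ))
  have hpd : (p : ℂ[X]).degree < n := mem_degreeLT.1 p.2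
  refine ⟨X ^ n - (p : ℂ[X]), monic_X_pow_sub hpd, ?_, key _ fun k => ?_⟩
  · apply natDegree_eq_of_degree_eq_some
    rw [degree_sub_eq_left_of_degree_lt] <;> simp [hpd]
  · have := congrFun hp k
    rw [pairing_sub_left hD hV, sub_eq_zero]
    exact this.symm

theorem IsOrthogonalSystem.pairing_eq {P : ℕ → ℂ[X]} {h : ℕ → ℝ}
    (H : IsOrthogonalSystem D V N P h) (m n : ℕ) :
    pairing D V N (P n) (P m) = if m = n then (h n : ℂ) else 0 :=
  H.orthogonal m n

theorem IsOrthogonalSystem.pairing_eq_zero (hD : Bornology.IsBounded D) (hV : Continuous V)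
    {P : ℕ → ℂ[X]} {h : ℕ → ℝ} (H : IsOrthogonalSystem D V N P h) {n : ℕ} (q : ℂ[X])
    (hq : q.degree < n) : pairing D V N q (P n) = 0 :=
  pairing_eq_zero_of_degree_lt hD hV H.monic H.natDegree_eq
    (fun k hk => by rw [H.pairing_eq, if_neg (by omega)]) q hq

theorem IsOrthogonalSystem.norm_ne_zero (hDo : IsOpen D) (hD0 : (0 : ℂ) ∈ D)
    (hD : Bornology.IsBounded D) (hV : Continuous V) {P : ℕ → ℂ[X]} {h : ℕ → ℝ}
    (H : IsOrthogonalSystem D V N P h) (n : ℕ) : (h n : ℂ) ≠ 0 := by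
  intro h0
  have h1 := H.pairing_eq n n
  rw [if_pos rfl, h0] at h1
  exact (H.monic n).ne_zero (eq_zero_of_pairing_self hDo hD0 hD hV h1)

theorem degree_sub_lt_of_monic {p q : ℂ[X]} {n : ℕ} (hp : p.Monic) (hq : q.Monic)
    (hpn : p.natDegree = n) (hqn : q.natDegree = n) : (p - q).degree < n := by
  have h1 : p.degree = n := by rw [degree_eq_natDegree hp.ne_zero, hpn]
  have h2 : q.degree = n := by rw [degree_eq_natDegree hq.ne_zero, hqn]
  rw [← h1]
  exact degree_sub_lt_left (h1.trans h2.symm) hp.ne_zero (hp.leadingCoeff.trans hq.leadingCoeff.symm)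

/-- The leading moment of an orthogonal polynomial. -/
theorem IsOrthogonalSystem.pairing_X_pow (hD : Bornology.IsBounded D) (hV : Continuous V)
    {P : ℕ → ℂ[X]} {h : ℕ → ℝ} (H : IsOrthogonalSystem D V N P h) (n : ℕ) :
    pairing D V N (X ^ n) (P n) = h n := by
  have h1 := H.pairing_eq_zero hD hV (n := n) (X ^ n - P n)
    (degree_sub_lt_of_monic (monic_X_pow n) (H.monic n) (natDegree_X_pow n) (H.natDegree_eq n))
  rw [pairing_sub_left hD hV, H.pairing_eq, if_pos rfl, sub_eq_zero] at h1
  exact h1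

theorem existsUnique_isOrthogonalSystem (hDo : IsOpen D) (hD0 : (0 : ℂ) ∈ D)
    (hD : Bornology.IsBounded D) (hV : Continuous V) :
    ∃! Ph : (ℕ → ℂ[X]) × (ℕ → ℝ), IsOrthogonalSystem D V N Ph.1 Ph.2 := by
  choose P hP hdeg horth using exists_monic_orthogonal (N := N) hDo hD0 hD hV
  have hlt : ∀ k n, k < n → (P k).degree < n := fun k n hk => by
    rw [degree_eq_natDegree (hP k).ne_zero, hdeg]
    exact_mod_cast hk
  have hsys : IsOrthogonalSystem D V N P
      fun n => ∫ z in D, ‖(P n).eval z‖ ^ 2 * Real.exp (-(N : ℝ) * V z) := by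
    refine ⟨hP, hdeg, fun m n => ?_⟩
    change pairing D V N (P n) (P m) = _
    rcases lt_trichotomy m n with hmn | rfl | hmn
    · rw [if_neg hmn.ne, pairing_eq_zero_symm (horth n _ (hlt m n hmn))]
    · rw [if_pos rfl, pairing_self]
    · rw [if_neg hmn.ne', horth m _ (hlt n m hmn)]
  refine ⟨(P, _), hsys, ?_⟩
  rintro ⟨Q, h⟩ hQ
  -- The difference of two candidates has degree below `n`, so it is orthogonal to both of them and
  -- hence to itself.
  have hPQ : Q = P := by
    funext n
    rw [← sub_eq_zero]
    have hd := degree_sub_lt_of_monic (hQ.monic n) (hP n) (hQ.natDegree_eq n) (hdeg n)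
    refine eq_zero_of_pairing_self (N := N) hDo hD0 hD hV ?_
    rw [pairing_sub_left hD hV, pairing_eq_zero_symm (hQ.pairing_eq_zero hD hV _ hd),
      pairing_eq_zero_symm (horth n _ hd), sub_zero]
  subst hPQ
  refine Prod.ext rfl (funext fun n => ?_)
  have h1 := hQ.pairing_eq n n
  rw [hsys.pairing_eq, if_pos rfl, if_pos rfl] at h1
  exact_mod_cast h1.symm

end pairing

/-! ### Weyl's lemma and Liouville's theorem -/

/-- An entire function of polynomial growth is a polynomial. -/
theorem exists_polynomial_of_growth {f : ℂ → ℂ} (hf : Differentiable ℂ f) {C R : ℝ} (hC : 0 ≤ C)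
    {m : ℕ} (hb : ∀ z, R < ‖z‖ → ‖f z‖ ≤ C * (‖z‖ + 1) ^ m) :
    ∃ p : ℂ[X], p.degree < ((m + 1 : ℕ) : WithBot ℕ) ∧ ∀ z, f z = p.eval z := by
  -- Cauchy's estimate on circles of radius `r`: the derivative of order `k > m` at 0 is
  -- `O(r^{m-k})`, in particular `O(1/r)`.
  have hvanish : ∀ k, m < k → iteratedDeriv k f 0 = 0 := by
    intro k hk
    have hle : ∀ᶠ r : ℝ in atTop,
        ‖iteratedDeriv k f 0‖ ≤ (k.factorial * C * 2 ^ m) * r⁻¹ := by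
      filter_upwards [eventually_gt_atTop R, eventually_ge_atTop 1] with r hr hr1
      have hr0 : 0 < r := by linarith
      have h1 := Complex.norm_iteratedDeriv_le_of_forall_mem_sphere_norm_le (c := 0) (R := r)
        (C := C * (r + 1) ^ m) k hr0 hf.diffContOnCl (fun z hz => by
          have hz' : ‖z‖ = r := by simpa using hz
          simpa [hz'] using hb z (by rw [hz']; exact hr))
      refine h1.trans ?_
      rw [div_le_iff₀ (by positivity)]
      have h2 : (r + 1) ^ m ≤ 2 ^ m * r ^ m := by
        rw [← mul_pow]
        exact pow_le_pow_left₀ (by linarith) (by linarith) m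
      have h3 : r ^ m * r ≤ r ^ k := by
        rw [← pow_succ]
        exact pow_le_pow_right₀ hr1 hk
      have h4 : r ^ m ≤ r⁻¹ * r ^ k := by
        rw [inv_mul_eq_div, le_div_iff₀ hr0]
        exact h3
      calc (k.factorial : ℝ) * (C * (r + 1) ^ m)
          ≤ k.factorial * (C * (2 ^ m * (r⁻¹ * r ^ k))) := by gcongr; exact h2.trans (by gcongr)
        _ = _ := by ring
    have hlim : Tendsto (fun r : ℝ => (k.factorial * C * 2 ^ m) * r⁻¹) atTop (𝓝 0) := by
      simpa using tendsto_inv_atTop_zero.const_mul (k.factorial * C * 2 ^ m)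
    have := ge_of_tendsto hlim hle
    exact norm_le_zero_iff.1 this
  refine ⟨∑ k ∈ Finset.range (m + 1),
    monomial k ((k.factorial : ℂ)⁻¹ * iteratedDeriv k f 0), ?_, fun z => ?_⟩
  · refine (degree_sum_le _ _).trans_lt ?_
    rw [Finset.sup_lt_iff (WithBot.bot_lt_coe _)]
    intro k hk
    refine (degree_monomial_le _ _).trans_lt ?_
    exact_mod_cast Finset.mem_range.1 hk
  · have h1 := Complex.hasSum_taylorSeries_of_entire hf 0 z
    have h2 : HasSum (fun n : ℕ => (n.factorial : ℂ)⁻¹ • (z - 0) ^ n • iteratedDeriv n f 0)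
        (∑ n ∈ Finset.range (m + 1),
          (n.factorial : ℂ)⁻¹ • (z - 0) ^ n • iteratedDeriv n f 0) :=
      hasSum_sum_of_ne_finset_zero fun k hk => by
        rw [hvanish k (by simpa using hk)]
        simp
    rw [h1.unique h2, eval_finsetSum]
    refine Finset.sum_congr rfl fun k _ => ?_
    simp only [eval_monomial, smul_eq_mul, sub_zero]
    ring

/-- If polynomials of bounded degree converge almost everywhere, then the limit is almost everywhere
a polynomial. -/
theorem exists_polynomial_of_ae_tendsto {p : ℕ → ℂ[X]} {u : ℂ → ℂ} {m : ℕ}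
    (hp : ∀ k, (p k).degree < (m : WithBot ℕ))
    (h : ∀ᵐ z, Tendsto (fun k => (p k).eval z) atTop (𝓝 (u z))) :
    ∃ q : ℂ[X], q.degree < (m : WithBot ℕ) ∧ ∀ᵐ z, u z = q.eval z := by
  have hinf : {z | Tendsto (fun k => (p k).eval z) atTop (𝓝 (u z))}.Infinite := by
    intro hfin
    have h1 : volume (Set.univ : Set ℂ) = 0 := by
      rw [← Set.union_compl_self {z | Tendsto (fun k => (p k).eval z) atTop (𝓝 (u z))},
        measure_union_null_iff]
      exact ⟨hfin.measure_zero _, h⟩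
    exact (NeZero.ne (volume : Measure ℂ)) (Measure.measure_univ_eq_zero.1 h1)
  -- Interpolation at `m` fixed points of convergence recovers every `p k`, so convergence at these
  -- points alone determines a polynomial limit.
  obtain ⟨S, hS, hcard⟩ := hinf.exists_subset_card_eq m
  have hp' : ∀ k, p k = Lagrange.interpolate S id fun i => (p k).eval i := fun k =>
    Lagrange.eq_interpolate Function.injective_id.injOn (by rw [hcard]; exact hp k)
  refine ⟨Lagrange.interpolate S id u, ?_, ?_⟩
  · rw [← hcard]
    exact Lagrange.degree_interpolate_lt _ Function.injective_id.injOn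
  · filter_upwards [h] with z hz
    refine tendsto_nhds_unique hz ?_
    have : (fun k => (p k).eval z) = fun k =>
        ∑ i ∈ S, (p k).eval i * (Lagrange.basis S id i).eval z := by
      funext k
      conv_lhs => rw [hp' k]
      simp [Lagrange.interpolate_apply, eval_finsetSum]
    rw [this, Lagrange.interpolate_apply, eval_finsetSum]
    refine tendsto_finsetSum _ fun i hi => ?_
    rw [eval_mul, eval_C]
    exact (show Tendsto _ _ _ from hS hi).mul_const _

/-- The test function `t ↦ ρ (x - t)` turns the weak equation for `u` into the Cauchy–Riemann
equation for `ρ * u` at `x`. -/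
theorem differentiable_convolution_of_hasWeakDbar_zero {u : ℂ → ℂ} (hu : LocallyIntegrable u)
    (hw : HasWeakDbar u fun _ => 0) {ρ : ℂ → ℝ} (hρ : ContDiff ℝ ∞ ρ)
    (hρc : HasCompactSupport ρ) :
    Differentiable ℂ (convolution ρ u (ContinuousLinearMap.lsmul ℝ ℝ) volume) := by
  intro x
  have hρ1 : ContDiff ℝ 1 ρ := hρ.of_le (by exact_mod_cast le_top)
  have hρd : Differentiable ℝ ρ := hρ1.differentiable one_ne_zero
  have hderiv := hρc.hasFDerivAt_convolution_left (ContinuousLinearMap.lsmul ℝ ℝ : ℝ →L[ℝ] ℂ →L[ℝ] ℂ)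
    (μ := volume) hρ1 hu x
  have hfc : Continuous (fderiv ℝ ρ) := hρ1.continuous_fderiv one_ne_zero
  have hex : ConvolutionExistsAt (fderiv ℝ ρ) u x
      ((ContinuousLinearMap.lsmul ℝ ℝ : ℝ →L[ℝ] ℂ →L[ℝ] ℂ).precompL ℂ) volume :=
    (hρc.fderiv ℝ).convolutionExists_left _ hfc hu x
  have hint := hex.integrable_swap
  have happ : ∀ v : ℂ, fderiv ℝ (convolution ρ u (ContinuousLinearMap.lsmul ℝ ℝ) volume) x v =
      ∫ t, (fderiv ℝ ρ (x - t) v : ℂ) * u t := by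
    intro v
    rw [hderiv.fderiv, convolution_eq_swap, ContinuousLinearMap.integral_apply hint]
    congr 1
  have hint' : ∀ v : ℂ, Integrable fun t => (fderiv ℝ ρ (x - t) v : ℂ) * u t := fun v => by
    have := hint.apply_continuousLinearMap v
    refine this.congr (Eventually.of_forall fun t => ?_)
    simp [ContinuousLinearMap.precompL_apply]
  rw [differentiableAt_complex_iff_differentiableAt_real]
  refine ⟨hderiv.differentiableAt, ?_⟩
  have htest := hw (fun t => ((ρ (x - t) : ℝ) : ℂ))
    (Complex.ofRealCLM.contDiff.comp (hρ.comp (contDiff_const.sub contDiff_id)))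
    ((hρc.comp_homeomorph (Homeomorph.subLeft x)).comp_left (g := fun r : ℝ => (r : ℂ)) (by simp))
  have hd : ∀ t, dbar (fun t => ((ρ (x - t) : ℝ) : ℂ)) t =
      -((fderiv ℝ ρ (x - t) 1 : ℂ) + Complex.I * (fderiv ℝ ρ (x - t) Complex.I : ℂ)) / 2 := by
    intro t
    have h1 : HasFDerivAt (fun t => ((ρ (x - t) : ℝ) : ℂ))
        (Complex.ofRealCLM.comp ((fderiv ℝ ρ (x - t)).comp (-ContinuousLinearMap.id ℝ ℂ))) t :=
      Complex.ofRealCLM.hasFDerivAt.comp t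
        ((hρd (x - t)).hasFDerivAt.comp t ((hasFDerivAt_id t).const_sub x))
    rw [dbar, h1.fderiv]
    simp
    ring
  simp only [hd] at htest
  rw [happ, happ, smul_eq_mul]
  have h2 : ∫ t, u t * (-((fderiv ℝ ρ (x - t) 1 : ℂ) +
      Complex.I * (fderiv ℝ ρ (x - t) Complex.I : ℂ)) / 2) =
      -((∫ t, (fderiv ℝ ρ (x - t) 1 : ℂ) * u t) +
        Complex.I * ∫ t, (fderiv ℝ ρ (x - t) Complex.I : ℂ) * u t) / 2 := by
    rw [← integral_const_mul, ← integral_add (hint' 1) ((hint' Complex.I).const_mul _),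
      ← integral_neg, ← integral_div]
    congr 1
    ext t
    ring
  rw [h2] at htest
  simp only [zero_mul, integral_zero, neg_zero] at htest
  set a := ∫ t, (fderiv ℝ ρ (x - t) 1 : ℂ) * u t
  set b := ∫ t, (fderiv ℝ ρ (x - t) Complex.I : ℂ) * u t
  linear_combination (2 * Complex.I) * htest + b * Complex.I_mul_I

/-- The value at `x` is an average of `u` over a ball of radius at most `r` about `x`, which stays
in the region where the growth bound holds. -/
theorem norm_convolution_normed_le (φ : ContDiffBump (0 : ℂ)) {u : ℂ → ℂ} {C R r : ℝ} (hC : 0 ≤ C)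
    (hr : φ.rOut ≤ r) {m : ℕ} (hb : ∀ᵐ z, R < ‖z‖ → ‖u z‖ ≤ C * ‖z‖ ^ m) (x : ℂ)
    (hx : R + r < ‖x‖) :
    ‖convolution (φ.normed volume) u (ContinuousLinearMap.lsmul ℝ ℝ) volume x‖ ≤
      C * (‖x‖ + r) ^ m := by
  rw [convolution_eq_swap]
  have hi : Integrable fun t => φ.normed volume (x - t) * (C * (‖x‖ + r) ^ m) :=
    (φ.integrable_normed.comp_sub_left x).mul_const _
  refine (norm_integral_le_of_norm_le hi ?_).trans_eq ?_
  · filter_upwards [hb] with t ht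
    rw [ContinuousLinearMap.lsmul_apply, norm_smul, Real.norm_of_nonneg (φ.nonneg_normed _)]
    by_cases h0 : φ.normed volume (x - t) = 0
    · simp [h0]
    · have hmem : x - t ∈ Function.support (φ.normed volume) := h0
      rw [φ.support_normed_eq, mem_ball_zero_iff] at hmem
      have h1 : ‖x‖ ≤ ‖t‖ + ‖x - t‖ := by simpa using norm_add_le t (x - t)
      have h2 : ‖t‖ ≤ ‖x‖ + ‖x - t‖ := by simpa using norm_sub_le x (x - t)
      gcongr
      · exact φ.nonneg_normed _
      · refine (ht (by linarith)).trans ?_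
        gcongr
        linarith
  · rw [integral_mul_const, integral_sub_left_eq_self (fun t => φ.normed volume t) volume x,
      φ.integral_normed, one_mul]

/-- Weyl's lemma together with Liouville's theorem: a distributional solution of `∂u/∂z̄ = 0` of
polynomial growth is almost everywhere equal to a polynomial. -/
theorem exists_polynomial_of_hasWeakDbar_zero {u : ℂ → ℂ} (hu : LocallyIntegrable u)
    (hw : HasWeakDbar u fun _ => 0) {C R : ℝ} (hC : 0 ≤ C) {m : ℕ}
    (hb : ∀ᵐ z, R < ‖z‖ → ‖u z‖ ≤ C * ‖z‖ ^ m) :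
    ∃ q : ℂ[X], q.degree < ((m + 1 : ℕ) : WithBot ℕ) ∧ ∀ᵐ z, u z = q.eval z := by
  -- The ratio 2 of the radii is the constant `K` required for almost everywhere convergence. Outer
  -- radii at most 1 give a growth bound, and hence a degree bound, independent of `k`.
  let φ : ℕ → ContDiffBump (0 : ℂ) := fun k =>
    { rIn := 1 / (2 * ((k : ℝ) + 1))
      rOut := 1 / ((k : ℝ) + 1)
      rIn_pos := by positivity
      rIn_lt_rOut := by
        apply one_div_lt_one_div_of_lt <;> [positivity; linarith [(k.cast_nonneg : (0 : ℝ) ≤ k)]] }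
  have hlim : ∀ᵐ z, Tendsto (fun k => convolution ((φ k).normed volume) u
      (ContinuousLinearMap.lsmul ℝ ℝ) volume z) atTop (𝓝 (u z)) :=
    ContDiffBump.ae_convolution_tendsto_right_of_locallyIntegrable (K := 2)
      tendsto_one_div_add_atTop_nhds_zero_nat (Eventually.of_forall fun k => by
        change 1 / ((k : ℝ) + 1) ≤ 2 * (1 / (2 * ((k : ℝ) + 1)))
        apply le_of_eq
        field_simp) hu
  have hpoly : ∀ k, ∃ p : ℂ[X], p.degree < ((m + 1 : ℕ) : WithBot ℕ) ∧ ∀ z,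
      convolution ((φ k).normed volume) u (ContinuousLinearMap.lsmul ℝ ℝ) volume z = p.eval z := by
    intro k
    refine exists_polynomial_of_growth (R := R + 1) (differentiable_convolution_of_hasWeakDbar_zero
      hu hw (φ k).contDiff_normed (φ k).hasCompactSupport_normed) hC fun z hz => ?_
    refine norm_convolution_normed_le (φ k) hC ?_ hb z hz
    change 1 / ((k : ℝ) + 1) ≤ 1
    rw [div_le_one (by positivity)]
    linarith [(k.cast_nonneg : (0 : ℝ) ≤ k)]
  choose p hp hpe using hpoly
  refine exists_polynomial_of_ae_tendsto hp ?_
  simpa only [hpe] using hlim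

/-! ### The Cauchy–Pompeiu formula -/

theorem continuous_dbar {φ : ℂ → ℂ} (hφ : ContDiff ℝ 1 φ) : Continuous (dbar φ) := by
  have h := hφ.continuous_fderiv one_ne_zero
  unfold dbar
  fun_prop

theorem hasCompactSupport_dbar {φ : ℂ → ℂ} (hφ : HasCompactSupport φ) :
    HasCompactSupport (dbar φ) := by
  refine (hφ.fderiv ℝ).comp_left
    (g := fun L : ℂ →L[ℝ] ℂ => (L 1 + Complex.I * L Complex.I) / 2) (by simp)

theorem exists_forall_le_norm_eq_zero {E : Type*} [Zero E] {φ : ℂ → E}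
    (hφ : HasCompactSupport φ) :
    ∃ R : ℝ, 0 < R ∧ ∀ z, R ≤ ‖z‖ → φ z = 0 := by
  obtain ⟨R, hR, h⟩ := hφ.isCompact.isBounded.exists_pos_norm_lt
  refine ⟨R, hR, fun z hz => ?_⟩
  by_contra h0
  exact absurd (h z (subset_tsupport φ h0)) (not_lt.2 hz)

/-- The Cauchy–Pompeiu formula for a compactly supported function. -/
theorem integral_dbar_div_self {φ : ℂ → ℂ} (hφ : ContDiff ℝ 1 φ) (hc : HasCompactSupport φ) :
    ∫ z, dbar φ z / z = -((Real.pi : ℂ) * φ 0) := by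
  have hd : Differentiable ℝ φ := hφ.differentiable one_ne_zero
  have hfc : Continuous (fderiv ℝ φ) := hφ.continuous_fderiv one_ne_zero
  obtain ⟨R, hR, hφR⟩ := exists_forall_le_norm_eq_zero hc
  obtain ⟨R', hR', hφR'⟩ := exists_forall_le_norm_eq_zero (hc.fderiv ℝ)
  -- In polar coordinates the Jacobian cancels `1 / r`, and the integrand becomes half of the radial
  -- derivative plus `i` times the angular derivative divided by `r`. The former integrates to `-φ
  -- 0` along each ray, the latter to 0 around each circle.
  let e : ℝ → ℂ := fun θ => Real.cos θ + Real.sin θ * Complex.I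
  have hec : Continuous e := by fun_prop
  have hen : ∀ θ, ‖e θ‖ = 1 := fun θ => by
    simp only [e]
    push_cast
    rw [← Complex.exp_mul_I, Complex.norm_exp_ofReal_mul_I]
  have hed : ∀ θ, HasDerivAt e (Complex.I * e θ) θ := fun θ => by
    have h1 := (Real.hasDerivAt_cos θ).ofReal_comp
    have h2 := ((Real.hasDerivAt_sin θ).ofReal_comp).mul_const Complex.I
    refine (h1.add h2).congr_deriv ?_
    simp only [e]
    push_cast
    linear_combination (-Complex.sin θ) * Complex.I_mul_I
  -- `c = 1` is the radial direction and `c = I` the angular one.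
  have hint : ∀ c : ℂ, IntegrableOn (fun p : ℝ × ℝ => fderiv ℝ φ (p.1 * e p.2) (c * e p.2))
      (Set.Ioi 0 ×ˢ Set.Ioo (-Real.pi) Real.pi) := by
    intro c
    have hcont : Continuous (fun p : ℝ × ℝ => fderiv ℝ φ (p.1 * e p.2) (c * e p.2)) :=
      (hfc.comp (by fun_prop)).clm_apply (by fun_prop)
    refine IntegrableOn.of_forall_sdiff_eq_zero (s := Set.Icc 0 R' ×ˢ Set.Icc (-Real.pi) Real.pi)
      (hcont.continuousOn.integrableOn_compact (isCompact_Icc.prod isCompact_Icc))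
      (measurableSet_Ioi.prod measurableSet_Ioo) ?_
    rintro ⟨r, θ⟩ ⟨⟨hr, hθ⟩, hn⟩
    have hr' : R' ≤ r := by
      by_contra! hlt
      exact hn ⟨⟨(Set.mem_Ioi.1 hr).le, hlt.le⟩, Set.Ioo_subset_Icc_self hθ⟩
    have : ‖(r : ℂ) * e θ‖ = r := by
      rw [norm_mul, hen, mul_one, Complex.norm_real, Real.norm_of_nonneg (Set.mem_Ioi.1 hr).le]
    simp only
    rw [hφR' _ (by rw [this]; exact hr')]
    simp
  have hradial : ∫ p in Set.Ioi (0 : ℝ) ×ˢ Set.Ioo (-Real.pi) Real.pi,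
      fderiv ℝ φ ((p.1 : ℂ) * e p.2) (1 * e p.2) = -(2 * Real.pi * φ 0) := by
    have hi := hint 1
    rw [IntegrableOn, Measure.volume_eq_prod, ← Measure.prod_restrict] at hi
    rw [Measure.volume_eq_prod, ← Measure.prod_restrict, integral_prod_symm _ hi]
    have hinner : ∀ θ : ℝ, ∫ r in Set.Ioi (0 : ℝ), fderiv ℝ φ ((r : ℂ) * e θ) (1 * e θ) = -φ 0 := by
      intro θ
      have hnorm : ∀ r : ℝ, 0 ≤ r → ‖(r : ℂ) * e θ‖ = r := fun r hr => by
        rw [norm_mul, hen, mul_one, Complex.norm_real, Real.norm_of_nonneg hr]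
      have h := integral_Ioi_of_hasDerivAt_of_tendsto' (a := 0) (m := 0)
        (f := fun r : ℝ => φ ((r : ℂ) * e θ))
        (f' := fun r : ℝ => fderiv ℝ φ ((r : ℂ) * e θ) (1 * e θ)) (fun r _ => ?_) ?_ ?_
      · rw [h]
        simp
      · have h1 : HasDerivAt (fun r : ℝ => (r : ℂ) * e θ) (1 * e θ) r :=
          ((hasDerivAt_id r).ofReal_comp).mul_const _
        exact (hd _).hasFDerivAt.comp_hasDerivAt r h1
      · have hcont : Continuous fun r : ℝ => fderiv ℝ φ ((r : ℂ) * e θ) (1 * e θ) :=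
          (hfc.comp (by fun_prop)).clm_apply (by fun_prop)
        refine IntegrableOn.of_forall_sdiff_eq_zero (s := Set.Icc 0 R')
          (hcont.continuousOn.integrableOn_compact isCompact_Icc) measurableSet_Ioi ?_
        rintro r ⟨hr, hn⟩
        have hr' : R' ≤ r := by
          by_contra! hlt
          exact hn ⟨(Set.mem_Ioi.1 hr).le, hlt.le⟩
        rw [hφR' _ (by rw [hnorm r (Set.mem_Ioi.1 hr).le]; exact hr')]
        simp
      · refine tendsto_const_nhds.congr' ?_
        filter_upwards [eventually_ge_atTop R] with r hr
        rw [hφR _ (by rw [hnorm r (hR.le.trans hr)]; exact hr)]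
    simp only [hinner]
    rw [setIntegral_const]
    simp only [Measure.real, Real.volume_Ioo, sub_neg_eq_add]
    rw [ENNReal.toReal_ofReal (by positivity), Complex.real_smul]
    push_cast
    ring
  have hangular : ∫ p in Set.Ioi (0 : ℝ) ×ˢ Set.Ioo (-Real.pi) Real.pi,
      fderiv ℝ φ ((p.1 : ℂ) * e p.2) (Complex.I * e p.2) = 0 := by
    have hi := hint Complex.I
    rw [Measure.volume_eq_prod] at hi ⊢
    rw [setIntegral_prod _ hi]
    refine setIntegral_eq_zero_of_forall_eq_zero fun r hr => ?_
    have hr0 : (r : ℝ) ≠ 0 := (Set.mem_Ioi.1 hr).ne'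
    have hder : ∀ θ : ℝ, HasDerivAt (fun θ : ℝ => φ ((r : ℂ) * e θ))
        (r • fderiv ℝ φ ((r : ℂ) * e θ) (Complex.I * e θ)) θ := by
      intro θ
      have h1 := (hed θ).const_mul (r : ℂ)
      have h2 := (hd _).hasFDerivAt.comp_hasDerivAt θ h1
      refine h2.congr_deriv ?_
      rw [← map_smul, Complex.real_smul]
    have hcont : Continuous fun θ : ℝ => fderiv ℝ φ ((r : ℂ) * e θ) (Complex.I * e θ) :=
      (hfc.comp (by fun_prop)).clm_apply (by fun_prop)
    have h3 := intervalIntegral.integral_eq_sub_of_hasDerivAt (a := -Real.pi) (b := Real.pi)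
      (fun θ _ => hder θ) ((hcont.const_smul r).intervalIntegrable _ _)
    have h4 : e Real.pi = e (-Real.pi) := by simp [e]
    rw [h4, sub_self, intervalIntegral.integral_smul, smul_eq_zero, or_iff_right hr0,
      intervalIntegral.integral_of_le (by linarith [Real.pi_pos]),
      integral_Ioc_eq_integral_Ioo] at h3
    exact h3
  rw [← Complex.integral_comp_polarCoord_symm]
  have hcongr : ∀ p ∈ Set.Ioi (0 : ℝ) ×ˢ Set.Ioo (-Real.pi) Real.pi,
      p.1 • (dbar φ (Complex.polarCoord.symm p) / Complex.polarCoord.symm p) =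
      (1 / 2 : ℂ) * (fderiv ℝ φ ((p.1 : ℂ) * e p.2) (1 * e p.2) +
        Complex.I * fderiv ℝ φ ((p.1 : ℂ) * e p.2) (Complex.I * e p.2)) := by
    rintro ⟨r, θ⟩ ⟨hr, -⟩
    have hr0 : (r : ℂ) ≠ 0 := by exact_mod_cast (Set.mem_Ioi.1 hr).ne'
    have he0 : e θ ≠ 0 := by
      rw [← norm_ne_zero_iff, hen]
      exact one_ne_zero
    have hp : Complex.polarCoord.symm (r, θ) = (r : ℂ) * e θ := by
      rw [Complex.polarCoord_symm_apply]
    rw [hp]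
    simp only [dbar, one_mul]
    have h1 : e θ = Real.cos θ • (1 : ℂ) + Real.sin θ • Complex.I := by simp [e]
    have h2 : Complex.I * e θ = -Real.sin θ • (1 : ℂ) + Real.cos θ • Complex.I := by
      simp only [e, Complex.real_smul]
      push_cast
      linear_combination (Complex.sin θ) * Complex.I_mul_I
    have h3 : e θ * (Real.cos θ - Real.sin θ * Complex.I) = 1 := by
      simp only [e]
      push_cast
      linear_combination (-Complex.sin θ ^ 2) * Complex.I_mul_I + Complex.sin_sq_add_cos_sq (θ : ℂ)
    set L := fderiv ℝ φ ((r : ℂ) * e θ)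
    have h4 : L (e θ) = Real.cos θ * L 1 + Real.sin θ * L Complex.I := by
      rw [h1, map_add, map_smul, map_smul, Complex.real_smul, Complex.real_smul]
    have h5 : L (Complex.I * e θ) = -Real.sin θ * L 1 + Real.cos θ * L Complex.I := by
      rw [h2, map_add, map_smul, map_smul, Complex.real_smul, Complex.real_smul]
      push_cast
      ring
    rw [h4, h5, Complex.real_smul]
    field_simp
    linear_combination (-(L 1 + Complex.I * L Complex.I)) * h3 -
      (e θ * Real.sin θ * L Complex.I) * Complex.I_mul_I
  rw [show polarCoord.target = Set.Ioi (0 : ℝ) ×ˢ Set.Ioo (-Real.pi) Real.pi from rfl,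
    setIntegral_congr_fun (measurableSet_Ioi.prod measurableSet_Ioo) hcongr, integral_const_mul,
    integral_add (hint 1) ((hint Complex.I).const_mul _), integral_const_mul, hradial, hangular]
  ring

theorem dbar_comp_add_left (φ : ℂ → ℂ) (a z : ℂ) :
    dbar (fun w => φ (a + w)) z = dbar φ (a + z) := by
  simp only [dbar, fderiv_comp_add_left]

theorem integral_dbar_div_sub {φ : ℂ → ℂ} (hφ : ContDiff ℝ 1 φ) (hc : HasCompactSupport φ)
    (a : ℂ) : ∫ z, dbar φ z / (a - z) = Real.pi * φ a := by
  have h := integral_dbar_div_self (φ := fun w => φ (a + w)) (hφ.comp (contDiff_const.add contDiff_id))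
    (hc.comp_homeomorph (Homeomorph.addLeft a))
  rw [← integral_add_left_eq_self (fun z => dbar φ z / (a - z)) a]
  simp only [dbar_comp_add_left, add_zero] at h
  rw [← neg_inj, ← h, ← integral_neg]
  congr 1
  ext z
  rw [show a - (a + z) = -z by ring, div_neg, neg_neg]

/-- The directional derivatives of a compactly supported function have integral zero. -/
theorem integral_fderiv_eq_zero {φ : ℂ → ℂ} (hφ : ContDiff ℝ 1 φ) (hc : HasCompactSupport φ)
    (v : ℂ) : ∫ z, fderiv ℝ φ z v = 0 := by
  have hfc : Continuous fun z => fderiv ℝ φ z v :=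
    (hφ.continuous_fderiv one_ne_zero).clm_apply continuous_const
  have h := integral_mul_fderiv_eq_neg_fderiv_mul_of_integrable (μ := (volume : Measure ℂ))
    (f := fun _ => (1 : ℂ)) (g := φ) (v := v) (by simp)
    (by simpa using hfc.integrable_of_hasCompactSupport (hc.fderiv_apply ℝ v))
    (by simpa using hφ.continuous.integrable_of_hasCompactSupport hc)
    (fun _ _ => differentiableAt_const _)
    (fun z _ => hφ.differentiable one_ne_zero z)
  simpa using h

theorem integral_dbar_eq_zero {φ : ℂ → ℂ} (hφ : ContDiff ℝ 1 φ) (hc : HasCompactSupport φ) :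
    ∫ z, dbar φ z = 0 := by
  have hfc : ∀ v, Integrable fun z => fderiv ℝ φ z v := fun v =>
    ((hφ.continuous_fderiv one_ne_zero).clm_apply continuous_const).integrable_of_hasCompactSupport
      (hc.fderiv_apply ℝ v)
  simp only [dbar]
  rw [integral_div, integral_add (hfc 1) ((hfc _).const_mul _), integral_const_mul,
    integral_fderiv_eq_zero hφ hc, integral_fderiv_eq_zero hφ hc]
  simp

theorem dbar_mul_of_differentiableAt {f φ : ℂ → ℂ} {z : ℂ} (hf : DifferentiableAt ℂ f z)
    (hφ : DifferentiableAt ℝ φ z) : dbar (fun w => f w * φ w) z = f z * dbar φ z := by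
  have hr := differentiableAt_complex_iff_differentiableAt_real.1 hf
  have h1 := hr.2
  simp only [dbar, fderiv_fun_mul hr.1 hφ, add_apply,
    smul_apply, h1, smul_eq_mul]
  linear_combination (φ z * fderiv ℝ f z 1 / 2) * Complex.I_mul_I

/-- Polynomials are weak solutions of `∂u/∂z̄ = 0`. -/
theorem hasWeakDbar_polynomial (p : ℂ[X]) : HasWeakDbar (fun z => p.eval z) fun _ => 0 := by
  intro φ hφ hc
  have hφ1 : ContDiff ℝ 1 φ := hφ.of_le (by exact_mod_cast le_top)
  have hp : ContDiff ℝ 1 fun z : ℂ => p.eval z := by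
    have : ContDiff ℂ 1 fun z : ℂ => p.eval z := by
      simpa [Polynomial.aeval_def] using p.contDiff_aeval (𝕜 := ℂ) (R := ℂ) 1
    exact this.restrict_scalars ℝ
  simp only [zero_mul, integral_zero, neg_zero]
  rw [← integral_dbar_eq_zero (hp.mul hφ1) hc.mul_left]
  refine integral_congr_ae (Eventually.of_forall fun z => ?_)
  exact (dbar_mul_of_differentiableAt p.differentiableAt (hφ1.differentiable one_ne_zero z)).symm

/-! ### Cauchy transforms of bounded, compactly supported densities -/

/-- The integral of a bounded measurable function against the translates of an integrable kernel is
continuous. -/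
theorem continuous_integral_mul_translate {f k : ℂ → ℂ} {M : ℝ} (hf : AEStronglyMeasurable f)
    (hM : ∀ z, ‖f z‖ ≤ M) (hk : Integrable k) : Continuous fun z => ∫ w, f w * k (w - z) := by
  have hM0 : 0 ≤ M := (norm_nonneg _).trans (hM 0)
  have hfl : LocallyIntegrable f := by
    refine (locallyIntegrable_const M).mono hf (Eventually.of_forall fun z => ?_)
    rw [Real.norm_of_nonneg hM0]
    exact hM z
  have hfi : ∀ {g : ℂ → ℂ}, Integrable g → ∀ z, Integrable fun w => f w * g (w - z) :=
    fun hg z => (hg.comp_sub_right z).bdd_mul hf (Eventually.of_forall hM)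
  refine continuous_of_uniform_approx_of_continuous fun s hs => ?_
  obtain ⟨ε, hε, hs⟩ := Metric.mem_uniformity_dist.1 hs
  -- An `L¹` error in the kernel costs at most `M` times itself, uniformly in `z`. The `+ 1` in the
  -- denominator allows `M = 0`.
  obtain ⟨g, hgc, hgε, hgcont, hgi⟩ :=
    hk.exists_hasCompactSupport_integral_sub_le (ε := ε / (2 * (M + 1))) (by positivity)
  refine ⟨fun z => ∫ w, f w * g (w - z), ?_, fun z => hs ?_⟩
  · have h := (hgc.comp_homeomorph (Homeomorph.neg ℂ)).continuous_convolution_right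
      (ContinuousLinearMap.mul ℝ ℂ) hfl (hgcont.comp continuous_neg) (μ := volume)
    refine h.congr fun z => ?_
    simp [convolution]
  · rw [dist_eq_norm, ← integral_sub (hfi hk z) (hfi hgi z)]
    have h1 : Integrable fun w => M * ‖k (w - z) - g (w - z)‖ :=
      (((hk.sub hgi).norm.comp_sub_right z).const_mul M)
    refine (norm_integral_le_of_norm_le h1 (Eventually.of_forall fun w => ?_)).trans_lt ?_
    · rw [← mul_sub, norm_mul]
      exact mul_le_mul_of_nonneg_right (hM w) (norm_nonneg _)
    · rw [integral_const_mul, integral_sub_right_eq_self (fun w => ‖k w - g w‖) z]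
      calc M * ∫ w, ‖k w - g w‖ ≤ (M + 1) * (ε / (2 * (M + 1))) := by
            gcongr
            linarith
        _ = ε / 2 := by field_simp
        _ < ε := by linarith

/-- The Cauchy kernel `1 / w`, cut off at distance `r`. -/
noncomputable def cutKernel (r : ℝ) : ℂ → ℂ := (Metric.ball 0 r).indicator fun w => w⁻¹

/-- The singularity `1 / ‖w‖` is cancelled by the Jacobian `r` of polar coordinates in the plane. -/
theorem integrable_cutKernel (r : ℝ) : Integrable (cutKernel r) := by
  have h : IntegrableOn (fun z : ℂ => ‖z‖⁻¹) (Metric.ball 0 r) := by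
    rw [integrableOn_fun_norm_addHaar volume (f := fun y : ℝ => y⁻¹)]
    refine (integrableOn_const (C := (1 : ℝ)) (by simp)).congr_fun (fun y hy => ?_)
      measurableSet_Ioo
    have : y ≠ 0 := hy.1.ne'
    simp [Complex.finrank_real_complex, this]
  unfold cutKernel
  rw [integrable_indicator_iff Metric.isOpen_ball.measurableSet]
  refine (integrable_norm_iff ?_).1 (by simpa only [IntegrableOn, norm_inv] using h)
  exact measurable_inv.aestronglyMeasurable

/-- The function is measurable, bounded, and vanishes outside the disc of radius `R`. -/
structure IsBoundedOnDisc (f : ℂ → ℂ) (M R : ℝ) : Prop where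
  aestronglyMeasurable : AEStronglyMeasurable f
  norm_le : ∀ z, ‖f z‖ ≤ M
  eq_zero : ∀ z, R ≤ ‖z‖ → f z = 0

/-- The (unnormalized) Cauchy transform. -/
noncomputable def cauchyTransform (f : ℂ → ℂ) (z : ℂ) : ℂ := ∫ w, f w / (w - z)

namespace IsBoundedOnDisc

variable {f : ℂ → ℂ} {M R : ℝ}

/-- On the support of `f` one has `‖w - z‖ < R + ‖z‖`, so the cut-off is invisible; it replaces the
Cauchy kernel by an integrable one. -/
theorem div_sub_eq (hf : IsBoundedOnDisc f M R) {r : ℝ} {z : ℂ} (hz : R + ‖z‖ ≤ r) (w : ℂ) :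
    f w / (w - z) = f w * cutKernel r (w - z) := by
  rcases le_or_gt R ‖w‖ with h | h
  · simp [hf.eq_zero w h]
  · rw [cutKernel, Set.indicator_of_mem, div_eq_mul_inv]
    rw [mem_ball_zero_iff]
    linarith [norm_sub_le w z]

theorem integrable_div_sub (hf : IsBoundedOnDisc f M R) (z : ℂ) :
    Integrable fun w => f w / (w - z) := by
  simp only [hf.div_sub_eq le_rfl]
  exact ((integrable_cutKernel _).comp_sub_right z).bdd_mul hf.aestronglyMeasurable
    (Eventually.of_forall hf.norm_le)

theorem integrable (hf : IsBoundedOnDisc f M R) : Integrable f := by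
  have h : IntegrableOn f (Metric.ball 0 R) :=
    Measure.integrableOn_of_bounded (M := M) measure_ball_lt_top.ne hf.aestronglyMeasurable
      (Eventually.of_forall hf.norm_le)
  refine (integrableOn_iff_integrable_of_support_subset fun z hz => ?_).1 h
  rw [mem_ball_zero_iff]
  by_contra! hle
  exact hz (hf.eq_zero z hle)

theorem continuous_cauchyTransform (hf : IsBoundedOnDisc f M R) :
    Continuous (cauchyTransform f) := by
  rw [continuous_iff_continuousAt]
  intro z
  -- The extra 1 in the radius makes one cut-off serve a whole neighbourhood of `z`.
  have h := (continuous_integral_mul_translate hf.aestronglyMeasurable hf.norm_le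
    (integrable_cutKernel (R + (‖z‖ + 1)))).continuousAt (x := z)
  refine h.congr ?_
  filter_upwards [continuous_norm.continuousAt.eventually_lt continuousAt_const
    (show ‖z‖ < ‖z‖ + 1 by linarith)] with y hy
  rw [cauchyTransform]
  simp only [hf.div_sub_eq (r := R + (‖z‖ + 1)) (z := y) (by linarith)]

/-- The Cauchy transform of `f` solves `∂u/∂z̄ = -π f`. -/
theorem hasWeakDbar_cauchyTransform (hf : IsBoundedOnDisc f M R) :
    HasWeakDbar (cauchyTransform f) fun z => -(Real.pi : ℂ) * f z := by
  intro φ hφ hc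
  have hφ1 : ContDiff ℝ 1 φ := hφ.of_le (by exact_mod_cast le_top)
  have hdc := hasCompactSupport_dbar hc
  have hd := continuous_dbar hφ1
  obtain ⟨R', -, hR'⟩ := exists_forall_le_norm_eq_zero hdc
  have hker : ∀ z w, f w / (w - z) * dbar φ z = f w * (dbar φ z * cutKernel (R + R') (w - z)) := by
    intro z w
    rcases le_or_gt R' ‖z‖ with h | h
    · simp [hR' z h]
    · rw [hf.div_sub_eq (r := R + R') (by linarith)]
      ring
  -- Fubini applies because the integrand is the bounded `f` times the convolution integrand of two
  -- `L¹` functions.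
  have hprod : Integrable (fun p : ℂ × ℂ => f p.1 / (p.1 - p.2) * dbar φ p.2)
      (volume.prod volume) := by
    simp only [hker]
    have h1 := (hd.integrable_of_hasCompactSupport hdc (μ := volume)).convolution_integrand
      (ContinuousLinearMap.mul ℝ ℂ) (integrable_cutKernel (R + R'))
    exact h1.bdd_mul hf.aestronglyMeasurable.comp_fst
      (Eventually.of_forall fun p => hf.norm_le p.1)
  calc ∫ z, cauchyTransform f z * dbar φ z = ∫ z, ∫ w, f w / (w - z) * dbar φ z := by
        simp only [cauchyTransform, integral_mul_const]
    _ = ∫ w, ∫ z, f w / (w - z) * dbar φ z := (integral_integral_swap hprod).symm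
    _ = ∫ w, f w * (Real.pi * φ w) := by
        congr 1
        ext w
        rw [← integral_dbar_div_sub hφ1 hc w, ← integral_const_mul]
        congr 1
        ext z
        ring
    _ = -∫ z, -(Real.pi : ℂ) * f z * φ z := by
        rw [← integral_neg]
        congr 1
        ext z
        ring

theorem isBigO_cauchyTransform (hf : IsBoundedOnDisc f M R) :
    cauchyTransform f =O[cocompact ℂ] fun z => 1 / z := by
  refine IsBigO.of_bound (2 * ∫ w, ‖f w‖) ?_
  -- For such `z`, every `w` in the support of `f` satisfies `‖w - z‖ ≥ ‖z‖ / 2`.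
  filter_upwards [tendsto_norm_cocompact_atTop.eventually_ge_atTop (2 * |R| + 1)] with z hz
  have hz0 : 0 < ‖z‖ := by linarith [abs_nonneg R]
  rw [cauchyTransform, mul_comm 2, mul_assoc, ← integral_mul_const]
  refine norm_integral_le_of_norm_le (hf.integrable.norm.mul_const _)
    (Eventually.of_forall fun w => ?_)
  rcases le_or_gt R ‖w‖ with h | h
  · simp [hf.eq_zero w h]
  · have h1 : ‖z‖ / 2 ≤ ‖w - z‖ := by
      have := norm_sub_norm_le z w
      rw [norm_sub_rev] at this
      linarith [le_abs_self R]
    rw [norm_div, norm_div, norm_one]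
    calc ‖f w‖ / ‖w - z‖ ≤ ‖f w‖ / (‖z‖ / 2) := by gcongr
      _ = ‖f w‖ * (2 * (1 / ‖z‖)) := by field_simp

theorem mul_id (hf : IsBoundedOnDisc f M R) : IsBoundedOnDisc (fun w => w * f w) (|R| * M) R := by
  refine ⟨continuous_id.aestronglyMeasurable.mul hf.aestronglyMeasurable, fun z => ?_, fun z hz => ?_⟩
  · have hM0 : 0 ≤ M := (norm_nonneg _).trans (hf.norm_le 0)
    rcases le_or_gt R ‖z‖ with h | h
    · rw [hf.eq_zero z h, mul_zero, norm_zero]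
      positivity
    · rw [norm_mul]
      exact mul_le_mul (h.le.trans (le_abs_self R)) (hf.norm_le z) (norm_nonneg _) (abs_nonneg R)
  · rw [hf.eq_zero z hz, mul_zero]

/-- This integrates `z / (w - z) = w / (w - z) - 1`, valid off the null set `w = z`. -/
theorem mul_cauchyTransform (hf : IsBoundedOnDisc f M R) (z : ℂ) :
    z * cauchyTransform f z = cauchyTransform (fun w => w * f w) z - ∫ w, f w := by
  unfold cauchyTransform
  rw [← integral_const_mul, ← integral_sub (hf.mul_id.integrable_div_sub z) hf.integrable]
  refine integral_congr_ae ?_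
  filter_upwards [Measure.ae_ne volume z] with w hw
  have : w - z ≠ 0 := sub_ne_zero.2 hw
  field_simp
  ring

theorem mul_pow (hf : IsBoundedOnDisc f M R) (n : ℕ) :
    ∃ M', IsBoundedOnDisc (fun w => w ^ n * f w) M' R := by
  induction n with
  | zero => exact ⟨M, by simpa using hf⟩
  | succ n ih =>
    obtain ⟨M', h⟩ := ih
    refine ⟨|R| * M', ?_⟩
    convert h.mul_id using 2
    ring

theorem pow_mul_cauchyTransform (hf : IsBoundedOnDisc f M R) (n : ℕ)
    (hmom : ∀ k < n, ∫ w, w ^ k * f w = 0) (z : ℂ) :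
    z ^ n * cauchyTransform f z = cauchyTransform (fun w => w ^ n * f w) z := by
  induction n with
  | zero => simp
  | succ n ih =>
    obtain ⟨M', h⟩ := hf.mul_pow n
    have h1 := h.mul_cauchyTransform z
    rw [hmom n (by omega), sub_zero] at h1
    rw [pow_succ', mul_assoc, ih fun k hk => hmom k (by omega), h1]
    congr 1
    ext w
    ring

end IsBoundedOnDisc

/-! ### The matrix `Y_n` solves the normalized problem -/

variable {D : Set ℂ} {V : ℂ → ℝ} {N : ℕ}

theorem HasWeakDbar.const_mul {u f : ℂ → ℂ} (h : HasWeakDbar u f) (c : ℂ) :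
    HasWeakDbar (fun z => c * u z) fun z => c * f z := by
  intro φ hφ hc
  simp only [mul_assoc, integral_const_mul]
  rw [h φ hφ hc, mul_neg]

/-- The density `conj(p) e^{-N V} χ_D`. -/
noncomputable def density (D : Set ℂ) (V : ℂ → ℝ) (N : ℕ) (p : ℂ[X]) : ℂ → ℂ :=
  D.indicator fun z => conj (p.eval z) * weight V N z

theorem exists_isBoundedOnDisc_density (hDo : IsOpen D) (hD : Bornology.IsBounded D)
    (hV : Continuous V) (p : ℂ[X]) : ∃ M R, IsBoundedOnDisc (density D V N p) M R := by
  have hc : Continuous fun z => conj (p.eval z) * weight V N z :=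
    (Complex.continuous_conj.comp p.continuous).mul (continuous_weight hV N)
  obtain ⟨R, -, hR⟩ := hD.exists_pos_norm_lt
  obtain ⟨M, hM⟩ := hD.isCompact_closure.exists_bound_of_continuousOn hc.continuousOn
  refine ⟨max M 0, R, hc.aestronglyMeasurable.indicator hDo.measurableSet, fun z => ?_,
    fun z hz => ?_⟩
  · by_cases hz : z ∈ D
    · rw [density, Set.indicator_of_mem hz]
      exact (hM z (subset_closure hz)).trans (le_max_left _ _)
    · rw [density, Set.indicator_of_notMem hz, norm_zero]
      exact le_max_right _ _
  · exact Set.indicator_of_notMem (fun h => absurd (hR z h) (not_lt.2 hz)) _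

theorem cauchyIntegral_eq (hDo : IsOpen D) (p : ℂ[X]) :
    cauchyIntegral D V N p = cauchyTransform (density D V N p) := by
  funext z
  rw [cauchyIntegral, cauchyTransform, ← integral_indicator hDo.measurableSet]
  congr 1
  ext w
  by_cases hw : w ∈ D
  · simp only [density, Set.indicator_of_mem hw]
    ring
  · simp [density, Set.indicator_of_notMem hw]

theorem integral_pow_mul_density (hDo : IsOpen D) (p : ℂ[X]) (k : ℕ) :
    ∫ w, w ^ k * density D V N p w = pairing D V N (X ^ k) p := by
  rw [pairing, ← integral_indicator hDo.measurableSet]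
  congr 1
  ext w
  by_cases hw : w ∈ D
  · simp only [density, Set.indicator_of_mem hw, eval_pow, eval_X]
    ring
  · simp [density, Set.indicator_of_notMem hw]

theorem conj_eval_mul_indicator (p : ℂ[X]) (z : ℂ) :
    conj (p.eval z) * D.indicator (weight V N) z = density D V N p z := by
  by_cases hz : z ∈ D
  · simp [density, hz]
  · simp [density, hz]

theorem rhs_apply_zero (A : Matrix (Fin 2) (Fin 2) ℂ) (z : ℂ) (i : Fin 2) :
    (A.map conj * (1 - matrixG D V N z)) i 0 = 0 := by
  simp [Matrix.mul_apply, matrixG, Fin.sum_univ_two]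

theorem rhs_apply_one (A : Matrix (Fin 2) (Fin 2) ℂ) (z : ℂ) (i : Fin 2) :
    (A.map conj * (1 - matrixG D V N z)) i 1 = -(conj (A i 0) * D.indicator (weight V N) z) := by
  simp [Matrix.mul_apply, matrixG, Fin.sum_univ_two]

theorem continuous_cauchyIntegral (hDo : IsOpen D) (hD : Bornology.IsBounded D)
    (hV : Continuous V) (p : ℂ[X]) : Continuous (cauchyIntegral D V N p) := by
  obtain ⟨M, R, h⟩ := exists_isBoundedOnDisc_density (N := N) hDo hD hV p
  rw [cauchyIntegral_eq hDo]
  exact h.continuous_cauchyTransform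

theorem hasWeakDbar_cauchyIntegral (hDo : IsOpen D) (hD : Bornology.IsBounded D)
    (hV : Continuous V) (p : ℂ[X]) :
    HasWeakDbar (cauchyIntegral D V N p) fun z => -(Real.pi : ℂ) * density D V N p z := by
  obtain ⟨M, R, h⟩ := exists_isBoundedOnDisc_density (N := N) hDo hD hV p
  rw [cauchyIntegral_eq hDo]
  exact h.hasWeakDbar_cauchyTransform

theorem continuous_matrixY (hDo : IsOpen D) (hD : Bornology.IsBounded D)
    (hV : Continuous V) (P : ℕ → ℂ[X]) (h : ℕ → ℝ) (n : ℕ) :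
    Continuous (matrixY D V N P h n) := by
  have h1 := continuous_cauchyIntegral (N := N) hDo hD hV (P n)
  have h2 := continuous_cauchyIntegral (N := N) hDo hD hV (P (n - 1))
  refine continuous_matrix fun i j => ?_
  fin_cases i <;> fin_cases j
  · exact (P n).continuous
  · exact continuous_const.mul h1
  · exact continuous_const.mul (P (n - 1)).continuous
  · exact continuous_const.mul h2

theorem solvesDbar_matrixY (hDo : IsOpen D) (hD : Bornology.IsBounded D)
    (hV : Continuous V) (P : ℕ → ℂ[X]) (h : ℕ → ℝ) (n : ℕ) :
    SolvesDbar D V N (matrixY D V N P h n) := by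
  have hpi : (Real.pi : ℂ) ≠ 0 := by exact_mod_cast Real.pi_ne_zero
  refine ⟨fun i j => ((continuous_matrixY hDo hD hV P h n).matrix_elem i j).locallyIntegrable,
    fun i j => ?_⟩
  have h00 : HasWeakDbar (fun z => (P n).eval z) fun _ => 0 := hasWeakDbar_polynomial (P n)
  have h10 : HasWeakDbar (fun z => -((Real.pi : ℂ) / (h (n - 1) : ℂ)) * (P (n - 1)).eval z)
      fun _ => 0 := by
    simpa only [mul_zero] using (hasWeakDbar_polynomial (P (n - 1))).const_mul
      (-((Real.pi : ℂ) / (h (n - 1) : ℂ)))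
  have h01 : HasWeakDbar (fun z => 1 / (Real.pi : ℂ) * cauchyIntegral D V N (P n) z)
      fun z => -(conj ((P n).eval z) * D.indicator (weight V N) z) := by
    convert (hasWeakDbar_cauchyIntegral (N := N) hDo hD hV (P n)).const_mul
      (1 / (Real.pi : ℂ)) using 2 with z
    rw [conj_eval_mul_indicator]
    field_simp
  have h11 : HasWeakDbar (fun z => -(1 / (h (n - 1) : ℂ)) * cauchyIntegral D V N (P (n - 1)) z)
      fun z => -(conj (-((Real.pi : ℂ) / (h (n - 1) : ℂ)) * (P (n - 1)).eval z) *
        D.indicator (weight V N) z) := by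
    convert (hasWeakDbar_cauchyIntegral (N := N) hDo hD hV (P (n - 1))).const_mul
      (-(1 / (h (n - 1) : ℂ))) using 2 with z
    rw [map_mul, mul_assoc, conj_eval_mul_indicator]
    -- The constant `π / h` is real, so conjugation does not change it.
    simp only [map_neg, map_div₀, Complex.conj_ofReal]
    ring
  fin_cases j
  · simp only [Fin.zero_eta, rhs_apply_zero]
    fin_cases i
    exacts [h00, h10]
  · simp only [Fin.mk_one, rhs_apply_one]
    fin_cases i
    exacts [h01, h11]

theorem isBigO_polynomial_div_pow {q : ℂ[X]} {n : ℕ} (hq : q.degree < n) :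
    (fun z : ℂ => q.eval z / z ^ n) =O[cocompact ℂ] fun z => 1 / z := by
  have h1 : (fun z : ℂ => q.eval z / z ^ n) =
      fun z => ∑ i ∈ Finset.range n, q.coeff i * (z ^ i / z ^ n) := by
    funext z
    rcases eq_or_ne q 0 with rfl | h0
    · simp
    · rw [eval_eq_sum_range' ((natDegree_lt_iff_degree_lt h0).2 hq), Finset.sum_div]
      simp only [mul_div_assoc]
  have h2 : ∀ i ∈ Finset.range n,
      (fun z : ℂ => z ^ i / z ^ n) =O[cocompact ℂ] fun z : ℂ => 1 / z := by
    intro i hi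
    refine IsBigO.of_bound 1 ?_
    filter_upwards [tendsto_norm_cocompact_atTop.eventually_ge_atTop 1] with z hz
    have hz0 : 0 < ‖z‖ := by linarith
    rw [norm_div, norm_div, norm_pow, norm_pow, norm_one, one_mul,
      div_le_div_iff₀ (by positivity) hz0, one_mul, ← pow_succ]
    exact pow_le_pow_right₀ hz (Finset.mem_range.1 hi)
  rw [h1]
  exact IsBigO.fun_sum fun i hi => (h2 i hi).const_mul_left _

/-- Away from `z = 0` the diagonal factor is invertible, which determines `E`. -/
theorem hasNormalization_of_isBigO {n : ℕ} {Y : ℂ → Matrix (Fin 2) (Fin 2) ℂ}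
    (h00 : (fun z => Y z 0 0 / z ^ n - 1) =O[cocompact ℂ] fun z => 1 / z)
    (h01 : (fun z => Y z 0 1 * z ^ n) =O[cocompact ℂ] fun z => 1 / z)
    (h10 : (fun z => Y z 1 0 / z ^ n) =O[cocompact ℂ] fun z => 1 / z)
    (h11 : (fun z => Y z 1 1 * z ^ n - 1) =O[cocompact ℂ] fun z => 1 / z) :
    HasNormalization n (cocompact ℂ) Y := by
  refine ⟨fun z => !![Y z 0 0 / z ^ n - 1, Y z 0 1 * z ^ n; Y z 1 0 / z ^ n, Y z 1 1 * z ^ n - 1],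
    fun i j => ?_, ?_⟩
  · fin_cases i <;> fin_cases j
    exacts [h00, h01, h10, h11]
  · filter_upwards [tendsto_norm_cocompact_atTop.eventually_gt_atTop 0] with z hz
    have hz0 : z ≠ 0 := norm_pos_iff.1 hz
    ext i j
    fin_cases i <;> fin_cases j <;> simp [Matrix.mul_apply, Fin.sum_univ_two, hz0]

theorem hasNormalization_matrixY (hDo : IsOpen D) (hD0 : (0 : ℂ) ∈ D)
    (hD : Bornology.IsBounded D) (hV : Continuous V) {P : ℕ → ℂ[X]} {h : ℕ → ℝ}
    (H : IsOrthogonalSystem D V N P h) {n : ℕ} (hn : 1 ≤ n) :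
    HasNormalization n (cocompact ℂ) (matrixY D V N P h n) := by
  obtain ⟨m, rfl⟩ : ∃ m, n = m + 1 := ⟨n - 1, by omega⟩
  have hmom : ∀ n, ∀ k < n, ∫ w, w ^ k * density D V N (P n) w = 0 := fun n k hk => by
    rw [integral_pow_mul_density hDo]
    exact H.pairing_eq_zero hD hV _ (by rw [degree_X_pow]; exact_mod_cast hk)
  refine hasNormalization_of_isBigO ?_ ?_ ?_ ?_
  · refine (isBigO_polynomial_div_pow (degree_sub_lt_of_monic (H.monic (m + 1))
      (monic_X_pow (m + 1)) (H.natDegree_eq _) (natDegree_X_pow _))).congr' ?_ EventuallyEq.rfl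
    filter_upwards [tendsto_norm_cocompact_atTop.eventually_gt_atTop 0] with z hz
    have hz0 : z ≠ 0 := norm_pos_iff.1 hz
    change _ = (P (m + 1)).eval z / z ^ (m + 1) - 1
    rw [eval_sub, eval_pow, eval_X, sub_div, div_self (pow_ne_zero _ hz0)]
  · obtain ⟨M, R, hb⟩ := exists_isBoundedOnDisc_density (N := N) hDo hD hV (P (m + 1))
    obtain ⟨M', hb'⟩ := hb.mul_pow (m + 1)
    refine (hb'.isBigO_cauchyTransform.const_mul_left (1 / (Real.pi : ℂ))).congr_left fun z => ?_
    rw [← hb.pow_mul_cauchyTransform (m + 1) (hmom _)]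
    change _ = 1 / (Real.pi : ℂ) * cauchyIntegral D V N (P (m + 1)) z * z ^ (m + 1)
    rw [cauchyIntegral_eq hDo]
    ring
  · have hdeg : (P m).degree < ((m + 1 : ℕ) : WithBot ℕ) := by
      rw [degree_eq_natDegree (H.monic m).ne_zero, H.natDegree_eq]
      exact_mod_cast m.lt_succ_self
    refine ((isBigO_polynomial_div_pow hdeg).const_mul_left
      (-((Real.pi : ℂ) / (h m : ℂ)))).congr_left fun z => ?_
    change _ = -((Real.pi : ℂ) / (h m : ℂ)) * (P m).eval z / z ^ (m + 1)
    ring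
  · obtain ⟨M, R, hb⟩ := exists_isBoundedOnDisc_density (N := N) hDo hD hV (P m)
    obtain ⟨M', hb'⟩ := hb.mul_pow m
    have hh := H.norm_ne_zero hDo hD0 hD hV m
    refine (hb'.mul_id.isBigO_cauchyTransform.const_mul_left (-(1 / (h m : ℂ)))).congr_left
      fun z => ?_
    -- The first `m` moments vanish, so `z ^ m` passes inside the transform; one more power of `z`
    -- splits off the moment of order `m`, which is `h m` and yields the leading 1.
    have h1 := hb'.mul_cauchyTransform z
    rw [← hb.pow_mul_cauchyTransform m (hmom m), integral_pow_mul_density hDo,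
      H.pairing_X_pow hD hV] at h1
    change _ = -(1 / (h m : ℂ)) * cauchyIntegral D V N (P m) z * z ^ (m + 1) - 1
    rw [cauchyIntegral_eq hDo, sub_eq_iff_eq_add.1 h1.symm]
    field_simp
    ring

/-! ### Uniqueness -/

theorem exists_smooth_cutoff : ∃ χ : ℂ → ℂ, ContDiff ℝ ∞ χ ∧ HasCompactSupport χ ∧
    (∀ z, ‖z‖ ≤ 1 → χ z = 1) ∧ ∀ z, 2 ≤ ‖z‖ → χ z = 0 := by
  let φ : ContDiffBump (0 : ℂ) :=
    { rIn := 1, rOut := 2, rIn_pos := one_pos, rIn_lt_rOut := one_lt_two }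
  refine ⟨fun z => ((φ z : ℝ) : ℂ), Complex.ofRealCLM.contDiff.comp φ.contDiff,
    φ.hasCompactSupport.comp_left (g := fun r : ℝ => (r : ℂ)) (by simp), fun z hz => ?_,
    fun z hz => ?_⟩
  · simp only [φ.one_of_mem_closedBall (x := z) (by simpa [φ] using hz), Complex.ofReal_one]
  · simp only [φ.zero_of_le_dist (x := z) (by simpa [φ] using hz), Complex.ofReal_zero]

theorem dbar_comp_smul {χ : ℂ → ℂ} (hχ : Differentiable ℝ χ) (r : ℝ) (z : ℂ) :
    dbar (fun w => χ (r • w)) z = r * dbar χ (r • z) := by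
  have h : HasFDerivAt (fun w : ℂ => χ (r • w))
      ((fderiv ℝ χ (r • z)).comp (r • ContinuousLinearMap.id ℝ ℂ)) z :=
    (hχ _).hasFDerivAt.comp z ((hasFDerivAt_id z).const_smul r)
  rw [dbar, h.fderiv]
  simp only [ContinuousLinearMap.comp_apply, smul_apply, ContinuousLinearMap.id_apply,
    map_smul (fderiv ℝ χ (r • z)), dbar]
  simp only [Complex.real_smul]
  ring

theorem dbar_eq_zero_of_eventuallyEq_const {χ : ℂ → ℂ} {c z : ℂ} (h : χ =ᶠ[𝓝 z] fun _ => c) :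
    dbar χ z = 0 := by
  simp [dbar, h.fderiv_eq]

/-- Green's formula with a smooth cut-off: for large `r` the test function `p(z) χ(z / r)` equals
`p` on `D`, so the weak equation expresses the pairing as the integral of `v p` against `∂/∂z̄` of
the cut-off. That derivative lives on `r ≤ ‖z‖ ≤ 2r` and is at most `K / r`, while `‖v p‖ ≤ |C| /
r²` almost everywhere there and the disc has area proportional to `4 r²`. The pairing is therefore
`O(1/r)`. -/
theorem pairing_self_eq_zero_of_hasWeakDbar (hDo : IsOpen D) (hD : Bornology.IsBounded D)
    {p : ℂ[X]} {v : ℂ → ℂ} (hw : HasWeakDbar v fun z => -density D V N p z) {C R : ℝ}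
    (hb : ∀ᵐ z, R < ‖z‖ → ‖v z * p.eval z‖ * ‖z‖ ^ 2 ≤ C) : pairing D V N p p = 0 := by
  obtain ⟨χ, hχ, hχc, hχ1, hχ0⟩ := exists_smooth_cutoff
  have hχ' : ContDiff ℝ 1 χ := hχ.of_le (by exact_mod_cast le_top)
  have hχd : Differentiable ℝ χ := hχ'.differentiable one_ne_zero
  obtain ⟨K, hK⟩ := (hasCompactSupport_dbar hχc).exists_bound_of_continuous
    (continuous_dbar hχ')
  have hd1 : ∀ z, ‖z‖ < 1 → dbar χ z = 0 := fun z hz =>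
    dbar_eq_zero_of_eventuallyEq_const (c := 1) <| by
      filter_upwards [continuous_norm.continuousAt.eventually_lt continuousAt_const hz] with y hy
      exact hχ1 y hy.le
  have hd2 : ∀ z, 2 < ‖z‖ → dbar χ z = 0 := fun z hz =>
    dbar_eq_zero_of_eventuallyEq_const (c := 0) <| by
      filter_upwards [continuousAt_const.eventually_lt continuous_norm.continuousAt hz] with y hy
      exact hχ0 y hy.le
  obtain ⟨R', hR', hDR⟩ := hD.exists_pos_norm_lt
  have hp : ContDiff ℝ ∞ fun z : ℂ => p.eval z := by
    have : ContDiff ℂ ∞ fun z : ℂ => p.eval z := by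
      simpa [Polynomial.aeval_def] using p.contDiff_aeval (𝕜 := ℂ) (R := ℂ) ∞
    exact this.restrict_scalars ℝ
  have key : ∀ r : ℝ, 0 < r → R' < r → R < r →
      ‖pairing D V N p p‖ ≤ (4 * |C| * K * volume.real (Metric.ball (0 : ℂ) 1)) * r⁻¹ := by
    intro r hr0 hr1 hr2
    have hnorm : ∀ z : ℂ, ‖r⁻¹ • z‖ = ‖z‖ / r := fun z => by
      rw [norm_smul, norm_inv, Real.norm_of_nonneg hr0.le, inv_mul_eq_div]
    have hscale : ContDiff ℝ ∞ fun z => χ (r⁻¹ • z) := hχ.comp (contDiff_const_smul _)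
    have hscaled : Differentiable ℝ fun z => χ (r⁻¹ • z) := hscale.differentiable (by simp)
    have htest := hw (fun z => p.eval z * χ (r⁻¹ • z)) (hp.mul hscale)
      (HasCompactSupport.mul_left (hχc.comp_smul (inv_ne_zero hr0.ne')))
    have hdz : ∀ z, dbar (fun z => p.eval z * χ (r⁻¹ • z)) z =
        p.eval z * (((r⁻¹ : ℝ) : ℂ) * dbar χ (r⁻¹ • z)) := fun z => by
      rw [dbar_mul_of_differentiableAt p.differentiableAt (hscaled z), dbar_comp_smul hχd]
    have hrhs : -∫ z, -density D V N p z * (p.eval z * χ (r⁻¹ • z)) = pairing D V N p p := by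
      rw [← integral_neg, pairing, ← integral_indicator hDo.measurableSet]
      congr 1
      ext z
      by_cases hz : z ∈ D
      · rw [hχ1 _ (by rw [hnorm, div_le_one hr0]; exact (hDR z hz).le.trans hr1.le)]
        simp only [density, Set.indicator_of_mem hz]
        ring
      · simp [density, Set.indicator_of_notMem hz]
    simp only [hdz] at htest
    rw [hrhs] at htest
    rw [← htest, ← setIntegral_eq_integral_of_forall_compl_eq_zero (s := Metric.closedBall 0 (2 * r))
      (fun z hz => ?_)]
    · refine (norm_setIntegral_le_of_norm_le_const_ae (C := |C| / r ^ 2 * (r⁻¹ * K))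
        measure_closedBall_lt_top ?_).trans_eq ?_
      · refine ae_restrict_of_ae ?_
        filter_upwards [hb] with z hz
        rcases lt_or_ge ‖z‖ r with hzr | hzr
        · rw [hd1 _ (by rw [hnorm, div_lt_one hr0]; exact hzr)]
          simp only [mul_zero, norm_zero]
          have := (norm_nonneg _).trans (hK 0)
          positivity
        · rw [← mul_assoc, norm_mul, norm_mul ((r⁻¹ : ℝ) : ℂ), Complex.norm_real,
            Real.norm_of_nonneg (inv_nonneg.2 hr0.le)]
          gcongr
          · rw [le_div_iff₀ (by positivity)]
            refine le_trans ?_ ((hz (hr2.trans_le hzr)).trans (le_abs_self C))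
            gcongr
          · exact hK _
      · rw [Measure.addHaar_real_closedBall _ _ (by positivity), Complex.finrank_real_complex]
        field_simp
        ring
    · rw [hd2 _ (by
        rw [hnorm, lt_div_iff₀ hr0]
        simpa using hz)]
      simp
  have hlim : Tendsto (fun r : ℝ => (4 * |C| * K * volume.real (Metric.ball (0 : ℂ) 1)) * r⁻¹)
      atTop (𝓝 0) := by
    simpa using tendsto_inv_atTop_zero.const_mul
      (4 * |C| * K * volume.real (Metric.ball (0 : ℂ) 1))
  refine norm_le_zero_iff.1 (ge_of_tendsto hlim ?_)
  filter_upwards [eventually_gt_atTop 0, eventually_gt_atTop R', eventually_gt_atTop R]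
    with r h0 h1 h2 using key r h0 h1 h2

theorem HasWeakDbar.congr_right {u f g : ℂ → ℂ} (h : HasWeakDbar u f) (hfg : f =ᵐ[volume] g) :
    HasWeakDbar u g := by
  intro φ hφ hc
  rw [h φ hφ hc]
  congr 1
  refine integral_congr_ae ?_
  filter_upwards [hfg] with z hz
  rw [hz]

/-- A row with trivial leading behaviour at infinity which solves the homogeneous problem
vanishes. -/
theorem ae_eq_zero_of_hasWeakDbar (hDo : IsOpen D) (hD0 : (0 : ℂ) ∈ D)
    (hD : Bornology.IsBounded D) (hV : Continuous V) {u v : ℂ → ℂ} (hu : LocallyIntegrable u)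
    (hv : LocallyIntegrable v) (hwu : HasWeakDbar u fun _ => 0)
    (hwv : HasWeakDbar v fun z => -(conj (u z) * D.indicator (weight V N) z)) {C R : ℝ} {m : ℕ}
    (hC : 0 ≤ C) (hbu : ∀ᵐ z, R < ‖z‖ → ‖u z‖ ≤ C * ‖z‖ ^ m)
    (hbv : ∀ᵐ z, R < ‖z‖ → ‖v z‖ * ‖z‖ ^ (m + 2) ≤ C) :
    u =ᵐ[volume] 0 ∧ v =ᵐ[volume] 0 := by
  obtain ⟨p, -, hup⟩ := exists_polynomial_of_hasWeakDbar_zero hu hwu hC hbu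
  have hp0 : p = 0 := by
    refine eq_zero_of_pairing_self (N := N) hDo hD0 hD hV
      (pairing_self_eq_zero_of_hasWeakDbar (v := v) (C := C * C) (R := R) hDo hD
        (hwv.congr_right ?_) ?_)
    · filter_upwards [hup] with z hz
      rw [hz, conj_eval_mul_indicator]
    · filter_upwards [hup, hbu, hbv] with z hz h1 h2 hR
      rw [← hz, norm_mul]
      calc ‖v z‖ * ‖u z‖ * ‖z‖ ^ 2 ≤ ‖v z‖ * (C * ‖z‖ ^ m) * ‖z‖ ^ 2 := by
            gcongr
            exact h1 hR
        _ = C * (‖v z‖ * ‖z‖ ^ (m + 2)) := by ring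
        _ ≤ C * C := by
            gcongr
            exact h2 hR
  have hu0 : u =ᵐ[volume] 0 := by
    filter_upwards [hup] with z hz
    simpa [hp0] using hz
  refine ⟨hu0, ?_⟩
  have hwv0 : HasWeakDbar v fun _ => 0 := by
    refine hwv.congr_right ?_
    filter_upwards [hu0] with z hz
    simp [hz]
  -- Beyond radius 1 the decay of `v` implies boundedness, so `m = 0` applies and `q` is constant.
  obtain ⟨q, hq, hvq⟩ := exists_polynomial_of_hasWeakDbar_zero (C := C) (R := max R 1) (m := 0)
    hv hwv0 hC <| by
      filter_upwards [hbv] with z h hz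
      rw [pow_zero, mul_one]
      refine le_trans ?_ (h ((le_max_left _ _).trans_lt hz))
      exact le_mul_of_one_le_right (norm_nonneg _)
        (one_le_pow₀ ((le_max_right R 1).trans hz.le))
  have hqC : q = Polynomial.C (q.coeff 0) :=
    eq_C_of_degree_le_zero <| by
    rw [degree_le_iff_coeff_zero]
    exact fun k hk => (degree_lt_iff_coeff_zero _ _).1 hq k (by exact_mod_cast hk)
  have hc0 : q.coeff 0 = 0 := by
    by_contra hne
    have hpos : 0 < ‖q.coeff 0‖ := norm_pos_iff.2 hne
    let T := max (max R 1) (C / ‖q.coeff 0‖)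
    -- The bounds hold only almost everywhere, so density supplies a point beyond `T` where both are
    -- valid; `T` is chosen so that a nonzero constant violates the decay.
    obtain ⟨z, ⟨hz1, hz2⟩, hzT⟩ := (Measure.dense_of_ae (hvq.and hbv)).exists_mem_open
      (U := {z : ℂ | T < ‖z‖}) (isOpen_lt continuous_const continuous_norm)
      ⟨((|T| + 1 : ℝ) : ℂ), by
        rw [Set.mem_ofPred_eq, Complex.norm_real, Real.norm_of_nonneg (by positivity)]
        linarith [le_abs_self T]⟩
    have h1 : ‖v z‖ = ‖q.coeff 0‖ := by
      rw [hz1, hqC]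
      simp
    have h2 := hz2 ((le_max_left R 1).trans (le_max_left _ _) |>.trans_lt hzT)
    have h3 : C < ‖q.coeff 0‖ * ‖z‖ := by
      rw [mul_comm, ← div_lt_iff₀ hpos]
      exact (le_max_right _ _).trans_lt hzT
    have h4 : ‖z‖ ≤ ‖z‖ ^ (m + 2) :=
      le_self_pow₀ ((le_max_right R 1).trans (le_max_left _ _) |>.trans hzT.le) (by omega)
    rw [h1] at h2
    exact absurd (h3.trans_le (mul_le_mul_of_nonneg_left h4 hpos.le)) (not_lt.2 h2)
  filter_upwards [hvq] with z hz
  rw [hz, hqC, hc0]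
  simp

theorem exists_ae_bound_of_isBigO {f g : ℂ → ℂ} (h : f =O[cocompact ℂ ⊓ ae volume] g) :
    ∃ C R : ℝ, 0 ≤ C ∧ ∀ᵐ z, R < ‖z‖ → ‖f z‖ ≤ C * ‖g z‖ := by
  obtain ⟨C, hC, hb⟩ := h.exists_nonneg
  obtain ⟨s, hs, hst⟩ := mem_inf_iff_superset.1 hb.bound
  obtain ⟨t, ht, hst⟩ := hst
  obtain ⟨R, hR⟩ := Metric.closedBall_compl_subset_of_mem_cocompact hs 0
  refine ⟨C, R, hC, ?_⟩
  filter_upwards [ht] with z hz hzR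
  exact hst ⟨hR (by simpa using hzR), hz⟩

theorem HasWeakDbar.sub {u u' f f' : ℂ → ℂ} (hu : LocallyIntegrable u)
    (hu' : LocallyIntegrable u') (hf : LocallyIntegrable f) (hf' : LocallyIntegrable f')
    (h : HasWeakDbar u f) (h' : HasWeakDbar u' f') :
    HasWeakDbar (fun z => u z - u' z) fun z => f z - f' z := by
  intro φ hφ hc
  have hφ1 : ContDiff ℝ 1 φ := hφ.of_le (by exact_mod_cast le_top)
  have hi : ∀ {g ψ : ℂ → ℂ}, LocallyIntegrable g → Continuous ψ → HasCompactSupport ψ →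
      Integrable fun z => g z * ψ z := fun hg hψ hψc =>
    hg.integrable_smul_right_of_hasCompactSupport hψ hψc
  have hd := continuous_dbar hφ1
  have hdc := hasCompactSupport_dbar hc
  simp only [sub_mul]
  rw [integral_sub (hi hu hd hdc) (hi hu' hd hdc),
    integral_sub (hi hf hφ.continuous hc) (hi hf' hφ.continuous hc), h φ hφ hc, h' φ hφ hc]
  ring

theorem locallyIntegrable_conj_mul_indicator (hDo : IsOpen D) (hV : Continuous V) {u : ℂ → ℂ}
    (hu : LocallyIntegrable u) :
    LocallyIntegrable fun z => -(conj (u z) * D.indicator (weight V N) z) := by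
  have h1 : LocallyIntegrable fun z => weight V N z * u z :=
    hu.continuous_mul (continuous_weight hV N)
  refine (h1.indicator hDo.measurableSet).mono ?_ (Eventually.of_forall fun z => ?_)
  · exact ((Complex.continuous_conj.comp_aestronglyMeasurable hu.aestronglyMeasurable).mul
      ((continuous_weight hV N).aestronglyMeasurable.indicator hDo.measurableSet)).neg
  · by_cases hz : z ∈ D
    · simp [hz, mul_comm]
    · simp [hz]

/-- The identity matrices in the two normalizations cancel, so the difference is an `O(1/z)` matrix
times the diagonal factor: the columns are `O(z^{n-1})` and `O(z^{-n-1})`. Conjugation is additive,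
so each row of the difference solves the homogeneous problem. -/
theorem ae_eq_of_solvesDbar (hDo : IsOpen D) (hD0 : (0 : ℂ) ∈ D)
    (hD : Bornology.IsBounded D) (hV : Continuous V) {n : ℕ} (hn : 1 ≤ n)
    {Y Z : ℂ → Matrix (Fin 2) (Fin 2) ℂ} (hY : SolvesDbar D V N Y) (hZ : SolvesDbar D V N Z)
    (hYn : HasNormalization n (cocompact ℂ ⊓ ae volume) Y)
    (hZn : HasNormalization n (cocompact ℂ ⊓ ae volume) Z) : Y =ᵐ[volume] Z := by
  obtain ⟨m, rfl⟩ : ∃ m, n = m + 1 := ⟨n - 1, by omega⟩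
  obtain ⟨E, hE, hYE⟩ := hYn
  obtain ⟨F, hF, hZF⟩ := hZn
  have hEF : ∀ i j, (fun z => E z i j - F z i j) =O[cocompact ℂ ⊓ ae volume] fun z => 1 / z :=
    fun i j => (hE i j).sub (hF i j)
  have hcol0 : ∀ i, (fun z => Y z i 0 - Z z i 0) =O[cocompact ℂ ⊓ ae volume]
      fun z => 1 / z * z ^ (m + 1) := fun i => by
    refine ((hEF i 0).mul (isBigO_refl (fun z : ℂ => z ^ (m + 1)) _)).congr' ?_ EventuallyEq.rfl
    filter_upwards [hYE, hZF] with z h1 h2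
    rw [h1, h2]
    simp [Matrix.mul_apply, Fin.sum_univ_two]
    ring
  have hcol1 : ∀ i, (fun z => Y z i 1 - Z z i 1) =O[cocompact ℂ ⊓ ae volume]
      fun z => 1 / z * (1 / z ^ (m + 1)) := fun i => by
    refine ((hEF i 1).mul (isBigO_refl (fun z : ℂ => 1 / z ^ (m + 1)) _)).congr' ?_
      EventuallyEq.rfl
    filter_upwards [hYE, hZF] with z h1 h2
    rw [h1, h2]
    simp [Matrix.mul_apply, Fin.sum_univ_two]
    ring
  have hrow : ∀ i, (fun z => Y z i 0 - Z z i 0) =ᵐ[volume] 0 ∧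
      (fun z => Y z i 1 - Z z i 1) =ᵐ[volume] 0 := by
    intro i
    obtain ⟨C₁, R₁, hC₁, hb₁⟩ := exists_ae_bound_of_isBigO (hcol0 i)
    obtain ⟨C₂, R₂, hC₂, hb₂⟩ := exists_ae_bound_of_isBigO (hcol1 i)
    have hw0 : ∀ {W}, SolvesDbar D V N W → HasWeakDbar (fun z => W z i 0) fun _ => 0 :=
      fun hW => by simpa only [rhs_apply_zero] using hW.dbar_eq i 0
    have hw1 : ∀ {W}, SolvesDbar D V N W → HasWeakDbar (fun z => W z i 1)
        fun z => -(conj (W z i 0) * D.indicator (weight V N) z) :=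
      fun hW => by simpa only [rhs_apply_one] using hW.dbar_eq i 1
    have hpos : ∀ z : ℂ, max (max R₁ R₂) 0 < ‖z‖ → 0 < ‖z‖ ∧ R₁ < ‖z‖ ∧ R₂ < ‖z‖ := fun z hz =>
      ⟨(le_max_right _ _).trans_lt hz,
        ((le_max_left _ _).trans (le_max_left _ _)).trans_lt hz,
        ((le_max_right _ _).trans (le_max_left _ _)).trans_lt hz⟩
    refine ae_eq_zero_of_hasWeakDbar (N := N) (C := max C₁ C₂) (R := max (max R₁ R₂) 0) (m := m)
      hDo hD0 hD hV ((hY.locallyIntegrable i 0).sub (hZ.locallyIntegrable i 0))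
      ((hY.locallyIntegrable i 1).sub (hZ.locallyIntegrable i 1)) ?_ ?_
      (hC₁.trans (le_max_left _ _)) ?_ ?_
    · simpa using HasWeakDbar.sub (hY.locallyIntegrable i 0) (hZ.locallyIntegrable i 0)
        (locallyIntegrable_const 0) (locallyIntegrable_const 0) (hw0 hY) (hw0 hZ)
    · refine (HasWeakDbar.sub (hY.locallyIntegrable i 1) (hZ.locallyIntegrable i 1)
        (locallyIntegrable_conj_mul_indicator hDo hV (hY.locallyIntegrable i 0))
        (locallyIntegrable_conj_mul_indicator hDo hV (hZ.locallyIntegrable i 0))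
        (hw1 hY) (hw1 hZ)).congr_right (Eventually.of_forall fun z => ?_)
      simp only [map_sub]
      ring
    · filter_upwards [hb₁] with z h hz
      obtain ⟨hz0, hz1, -⟩ := hpos z hz
      refine (h hz1).trans ?_
      have : ‖1 / z * z ^ (m + 1)‖ = ‖z‖ ^ m := by
        rw [norm_mul, norm_div, norm_one, norm_pow, pow_succ]
        field_simp
      rw [this]
      gcongr
      exact le_max_left _ _
    · filter_upwards [hb₂] with z h hz
      obtain ⟨hz0, -, hz2⟩ := hpos z hz
      refine le_trans (mul_le_mul_of_nonneg_right (h hz2) (by positivity)) ?_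
      have : ‖1 / z * (1 / z ^ (m + 1))‖ * ‖z‖ ^ (m + 2) = 1 := by
        rw [norm_mul, norm_div, norm_div, norm_one, norm_pow, pow_succ _ (m + 1)]
        field_simp
      rw [mul_assoc, this, mul_one]
      exact le_max_right _ _
  filter_upwards [(hrow 0).1, (hrow 0).2, (hrow 1).1, (hrow 1).2] with z h00 h01 h10 h11
  ext i j
  fin_cases i <;> fin_cases j
  exacts [sub_eq_zero.1 h00, sub_eq_zero.1 h01, sub_eq_zero.1 h10, sub_eq_zero.1 h11]

theorem HasNormalization.mono {n : ℕ} {l l' : Filter ℂ} {Y : ℂ → Matrix (Fin 2) (Fin 2) ℂ}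
    (h : HasNormalization n l Y) (hl : l' ≤ l) : HasNormalization n l' Y := by
  obtain ⟨E, hE, hY⟩ := h
  exact ⟨E, fun i j => (hE i j).mono hl, hl hY⟩

end DbarProblem

/-- `cocompact ℂ` is the filter `|z| → ∞`; as a locally integrable solution is a function defined
almost everywhere, it is compared with `Y_n` under the (weaker) assumption that the normalization
holds for almost every `z` as `|z| → ∞`. -/
theorem proposition1 (D : Set ℂ) (hDopen : IsOpen D) (hDconn : IsConnected D)
    (hDbdd : Bornology.IsBounded D) (hD0 : (0 : ℂ) ∈ D)
    (V : ℂ → ℝ) (hV : ContDiff ℝ ∞ V) (N : ℕ) :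
    -- the orthogonal polynomials exist and are unique
    (∃! Ph : (ℕ → ℂ[X]) × (ℕ → ℝ), DbarProblem.IsOrthogonalSystem D V N Ph.1 Ph.2) ∧
    ∀ (P : ℕ → ℂ[X]) (h : ℕ → ℝ), DbarProblem.IsOrthogonalSystem D V N P h →
      ∀ n : ℕ, 1 ≤ n →
        -- `Y_n` is continuous and solves the normalized problem
        (Continuous (DbarProblem.matrixY D V N P h n) ∧
          DbarProblem.SolvesDbar D V N (DbarProblem.matrixY D V N P h n) ∧
          DbarProblem.HasNormalization n (cocompact ℂ) (DbarProblem.matrixY D V N P h n)) ∧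
        -- every locally integrable solution equals `Y_n` almost everywhere
        (∀ Y : ℂ → Matrix (Fin 2) (Fin 2) ℂ, DbarProblem.SolvesDbar D V N Y →
          DbarProblem.HasNormalization n (cocompact ℂ ⊓ ae volume) Y →
          Y =ᵐ[volume] DbarProblem.matrixY D V N P h n) ∧
        -- every continuous solution equals `Y_n` everywhere
        (∀ Y : ℂ → Matrix (Fin 2) (Fin 2) ℂ, Continuous Y → DbarProblem.SolvesDbar D V N Y →
          DbarProblem.HasNormalization n (cocompact ℂ) Y →
          Y = DbarProblem.matrixY D V N P h n) := by
  have hVc := hV.continuous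
  refine ⟨DbarProblem.existsUnique_isOrthogonalSystem hDopen hD0 hDbdd hVc,
    fun P h H n hn => ?_⟩
  have hcont := DbarProblem.continuous_matrixY (N := N) hDopen hDbdd hVc P h n
  have hsol := DbarProblem.solvesDbar_matrixY (N := N) hDopen hDbdd hVc P h n
  have hnorm := DbarProblem.hasNormalization_matrixY hDopen hD0 hDbdd hVc H hn
  have huniq : ∀ Y : ℂ → Matrix (Fin 2) (Fin 2) ℂ, DbarProblem.SolvesDbar D V N Y →
      DbarProblem.HasNormalization n (cocompact ℂ ⊓ ae volume) Y →
      Y =ᵐ[volume] DbarProblem.matrixY D V N P h n := fun Y hY hYn =>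
    DbarProblem.ae_eq_of_solvesDbar hDopen hD0 hDbdd hVc hn hY hsol hYn (hnorm.mono inf_le_left)
  exact ⟨⟨hcont, hsol, hnorm⟩, huniq, fun Y hYc hY hYn =>
    (hYc.ae_eq_iff_eq volume hcont).1 (huniq Y hY (hYn.mono inf_le_left))⟩
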